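/- Let $K$ be a field and $n,m\ge 0$. Let $S=K[x_1,\dots,x_n]$ with the standard grading, and let $A=K[x_1,\dots,x_n,y_1,\dots,y_m]$ with the bigrading $\deg x_i=(1,0)$, $\deg y_t=(p_t,1)$, where $p_1,\dots,p_m\ge 0$ are integers. Put $\mathfrak m=(x_1,\dots,x_n)$. Let $M$ be a finitely generated $\mathbb Z$-graded $S$-module and $N=\bigoplus_{(a,k)\in\mathbb Z^2}N_{(a,k)}$ a finitely generated bigraded $A$-module; for $k\in\mathbb Z$ let $N_k=\bigoplus_{a}N_{(a,k)}$, a graded $S$-module. For a graded $S$-module $V$, the graded $S$-modules $\operatorname{Tor}^S_l(M,V)=H_l(F\otimes_S V)$ and $\operatorname{Ext}_S^l(M,V)=H^l(\operatorname{Hom}_S(F,V))$ are computed from a resolution $F$ of $M$ by finitely generated graded free $S$-modules; for $V=N$ they are $A$-modules through the action of $A$ on $N$. For a finitely generated graded $S$-module $T$ of Krull dimension $d$ let $H_0(T,x)=\dim_K T_x$ and $H_i(T,x)=\sum_{t\le x}H_{i-1}(T,t)$ for $i\ge 1$. The higher iterated Hilbert coefficients $e^i_j(T)\in\mathbb Z$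 are defined by $$H_i(T,x)=\sum_{j=0}^{d+i-1}(-1)^j e^i_j(T)\binom{x+d+i-j-1}{d+i-j-1}\qquad\text{for all } x\gg 0,$$ and $e^i_j(T)=0$ for $j>d+i-1$; if $T=0$, all of them are $0$. Then for all integers $l,i,j\ge 0$: 1. There are polynomials $q,q'\in\mathbb Q[X]$, each of which is zero or of degree at most $m-1+j$, such that $e^i_j(\operatorname{Tor}^S_l(M,N_k))=q(k)$ and $e^i_j(\operatorname{Ext}_S^l(M,N_k))=q'(k)$ for all $k\gg 0$. 2. If all $p_t$ are equal, then $q=0$ or $\deg q\le \dim \operatorname{Tor}^S_l(M,N)/\mathfrak m\operatorname{Tor}^S_l(M,N)+j-1$, and $q'=0$ or $\deg q'\le\dim\operatorname{Ext}_S^l(M,N)/\mathfrak m\operatorname{Ext}_S^l(M,N)+j-1$, where $\dim$ is the Krull dimension of an $A$-module, and the dimension of the zero module is $-\infty$. -/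

import Mathlib

open Filter MvPolynomial
open scoped TensorProduct

noncomputable section

namespace BigradedHilbert

/-! ### The rings `S = K[x_1, …, x_n]` and `A = K[x_1, …, x_n, y_1, …, y_m]` -/

/-- The polynomial ring `S = K[x_1, …, x_n]`. -/
abbrev PolyS (K : Type*) [Field K] (n : ℕ) : Type _ := MvPolynomial (Fin n) K

/-- The polynomial ring `A = K[x_1, …, x_n, y_1, …, y_m]`; the left summand of the index type
indexes the `x`-variables, the right summand the `y`-variables. -/
abbrev PolyA (K : Type*) [Field K] (n m : ℕ) : Type _ := MvPolynomial (Fin n ⊕ Fin m) K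

/-- `A` is an `S`-algebra through the inclusion `x_i ↦ x_i`. -/
instance algebraSA (K : Type*) [Field K] (n m : ℕ) : Algebra (PolyS K n) (PolyA K n m) :=
  (MvPolynomial.rename (R := K) (Sum.inl : Fin n → Fin n ⊕ Fin m)).toRingHom.toAlgebra

/-- The standard grading of `S`: `deg x_i = 1`. -/
def gradingS (K : Type*) [Field K] (n : ℕ) (c : ℤ) : Submodule K (PolyS K n) :=
  weightedHomogeneousSubmodule K (fun _ => (1 : ℤ)) c

/-- The bigrading of `A`: `deg x_i = (1, 0)` and `deg y_j = (p_j, 1)`. -/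
def gradingA (K : Type*) [Field K] (n : ℕ) {m : ℕ} (p : Fin m → ℕ) (c : ℤ × ℤ) :
    Submodule K (PolyA K n m) :=
  weightedHomogeneousSubmodule K
    (Sum.elim (fun _ => ((1 : ℤ), (0 : ℤ))) (fun j => ((p j : ℤ), (1 : ℤ)))) c

/-- The ideal `𝔪 = (x_1, …, x_n)` of `A`. -/
def idealX (K : Type*) [Field K] (n m : ℕ) : Ideal (PolyA K n m) :=
  Ideal.span (Set.range fun i : Fin n => (X (Sum.inl i) : PolyA K n m))

/-! ### Iterated Hilbert functions and coefficients of graded `S`-modules -/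

section Hilbert

variable {K : Type*} [Field K] {T : Type*} [AddCommGroup T] [Module K T]

/-- The iterated Hilbert functions: `H_0(T, k) = dim_K T_k` and
`H_{i+1}(T, k) = ∑_{t ≤ k} H_i(T, t)`. (For a finitely generated graded `S`-module `T` the
components `T_t` are finite dimensional, and zero for `t ≪ 0`, so that the sum is finite.) -/
def iterHilbert (𝒯 : ℤ → Submodule K T) : ℕ → ℤ → ℕ
  | 0, k => Module.finrank K (𝒯 k)
  | i + 1, k => ∑ᶠ t : Set.Iic k, iterHilbert 𝒯 i t

/-- The number `d + i` of coefficients of the `i`-th Hilbert polynomial, which has degree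
`d + i - 1`, where `d` is the Krull dimension of the `S`-module `T` (and `0` if `T = 0`). -/
def numCoeff (n : ℕ) (T : Type*) [AddCommGroup T] [Module (PolyS K n) T] (i : ℕ) : ℕ :=
  ((Module.supportDim (PolyS K n) T + (i : WithBot ℕ∞)).unbotD 0).toNat

/-- The value at `x` of `∑_{j=0}^{r-1} (-1)^j c_j binom(x + r - 1 - j, r - 1 - j)`. -/
def binomExpansion (r : ℕ) (c : ℕ → ℤ) (x : ℤ) : ℤ :=
  ∑ j ∈ Finset.range r,
    (-1) ^ j * c j * Ring.choose (x + ((r - 1 - j : ℕ) : ℤ)) (r - 1 - j)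

/-- `c_j = e^i_j(T)` for all `j`, that is:
`H_i(T, x) = P^i_T(x) = ∑_{j=0}^{d+i-1} (-1)^j c_j binom(x + d + i - j - 1, d + i - j - 1)` for all
`x ≫ 0`, where `d = dim T`, and `c_j = 0` for `j > d + i - 1`. -/
def IsHilbertCoeffs {n : ℕ} [Module (PolyS K n) T] (𝒯 : ℤ → Submodule K T) (i : ℕ)
    (c : ℕ → ℤ) : Prop :=
  (∀ᶠ x : ℤ in atTop, (iterHilbert 𝒯 i x : ℤ) = binomExpansion (numCoeff (K := K) n T i) c x) ∧
    ∀ j, numCoeff (K := K) n T i ≤ j → c j = 0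

/-- The `i`-th Hilbert polynomial of `T` exists, and its `j`-th coefficient `e^i_j(T)` is `a`. -/
def IsHilbertCoeff (n : ℕ) [Module (PolyS K n) T] (𝒯 : ℤ → Submodule K T) (i j : ℕ)
    (a : ℚ) : Prop :=
  ∃ c : ℕ → ℤ, IsHilbertCoeffs (n := n) 𝒯 i c ∧ (c j : ℚ) = a

end Hilbert

theorem binom_sum_eq_zero (r : ℕ) : ∀ b : ℕ → ℤ,
    (∀ᶠ x : ℤ in atTop, ∑ t ∈ Finset.range r, b t * Ring.choose (x + (t : ℤ)) t = 0) →
    ∀ t < r, b t = 0 := by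
  induction r with
  | zero => intro b _ t ht; omega
  | succ r ih =>
    intro b hb
    obtain ⟨x₀, hx₀⟩ := eventually_atTop.1 hb
    have h1 : ∀ t < r, b (t + 1) = 0 := by
      apply ih (fun t => b (t + 1))
      refine eventually_atTop.2 ⟨x₀ + 1, fun x hx => ?_⟩
      have e1 := hx₀ x (by omega)
      have e2 := hx₀ (x - 1) (by omega)
      rw [Finset.sum_range_succ'] at e1 e2
      have : ∀ t : ℕ, b (t + 1) * Ring.choose (x + ((t + 1 : ℕ) : ℤ)) (t + 1) =
          b (t + 1) * Ring.choose (x - 1 + ((t + 1 : ℕ) : ℤ)) (t + 1) +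
          b (t + 1) * Ring.choose (x + (t : ℤ)) t := by
        intro t
        have h : x + ((t + 1 : ℕ) : ℤ) = (x + (t : ℤ)) + 1 := by push_cast; ring
        have h' : x - 1 + ((t + 1 : ℕ) : ℤ) = x + (t : ℤ) := by push_cast; ring
        rw [h, h', Ring.choose_succ_succ]; ring
      rw [Finset.sum_congr rfl fun t _ => this t, Finset.sum_add_distrib] at e1
      simp only [Ring.choose_zero_right] at e1 e2
      linarith
    intro t ht
    rcases t with _ | t
    · have e1 := hx₀ x₀ le_rfl
      rw [Finset.sum_range_succ', Finset.sum_eq_zero] at e1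
      · simpa using e1
      · intro t ht; rw [h1 t (Finset.mem_range.1 ht), zero_mul]
    · exact h1 t (by omega)

/-- The coefficient `e^i_j(T)` is unique. -/
theorem IsHilbertCoeff.unique {K : Type*} [Field K] {T : Type*} [AddCommGroup T] [Module K T]
    {n : ℕ} [Module (PolyS K n) T] {𝒯 : ℤ → Submodule K T} {i j : ℕ} {a b : ℚ}
    (ha : IsHilbertCoeff n 𝒯 i j a) (hb : IsHilbertCoeff n 𝒯 i j b) : a = b := by
  obtain ⟨c, ⟨hc, hc0⟩, rfl⟩ := ha
  obtain ⟨e, ⟨he, he0⟩, rfl⟩ := hb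
  set r := numCoeff (K := K) n T i
  rcases le_or_gt r j with h | h
  · rw [hc0 j h, he0 j h]
  have key := binom_sum_eq_zero r
    (fun t => (-1) ^ (r - 1 - t) * (c (r - 1 - t) - e (r - 1 - t))) (by
      filter_upwards [hc, he] with x h1 h2
      have h3 : binomExpansion r c x - binomExpansion r e x = 0 := by rw [← h1, ← h2, sub_self]
      rw [binomExpansion, binomExpansion, ← Finset.sum_sub_distrib,
        ← Finset.sum_range_reflect] at h3
      rw [← h3]
      refine Finset.sum_congr rfl fun t ht => ?_
      have ht := Finset.mem_range.1 ht
      have : r - 1 - (r - 1 - t) = t := by omega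
      rw [this]; ring) (r - 1 - j) (by omega)
  have hj : r - 1 - (r - 1 - j) = j := by omega
  simp only [hj] at key
  have : c j - e j = 0 := by
    rcases mul_eq_zero.1 key with h | h
    · exact absurd h (by positivity)
    · exact h
  rw [sub_eq_zero.1 this]

/-! ### The graded components `N_k` of a bigraded `A`-module -/

section Component

variable {K : Type*} [Field K] {n m : ℕ} {p : Fin m → ℕ} {N : Type*} [AddCommGroup N]
  [Module K N] [Module (PolyS K n) N] [Module (PolyA K n m) N]
  [IsScalarTower K (PolyS K n) N] [IsScalarTower (PolyS K n) (PolyA K n m) N]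

/-- The graded `S`-module `N_k = ⨁_i N_{(i,k)}`, as an `S`-submodule of the bigraded
`A`-module `N`. -/
def component (p : Fin m → ℕ) (𝓝 : ℤ × ℤ → Submodule K N) [SetLike.GradedSMul (gradingA K n p) 𝓝]
    (k : ℤ) : Submodule (PolyS K n) N where
  carrier := (⨆ i : ℤ, 𝓝 (i, k) : Submodule K N)
  add_mem' := Submodule.add_mem _
  zero_mem' := Submodule.zero_mem _
  smul_mem' := by
    have hX : ∀ (s : Fin n) (u : N), u ∈ (⨆ i : ℤ, 𝓝 (i, k) : Submodule K N) →
        (X s : PolyS K n) • u ∈ (⨆ i : ℤ, 𝓝 (i, k) : Submodule K N) := by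
      intro s u hu
      induction hu using Submodule.iSup_induction' with
      | mem i v hv =>
        have h1 : (X (Sum.inl s) : PolyA K n m) ∈ gradingA K n p (1, 0) :=
          isWeightedHomogeneous_X K _ (Sum.inl s)
        have h2 : (X (Sum.inl s) : PolyA K n m) • v ∈ 𝓝 ((1, 0) + (i, k)) :=
          SetLike.GradedSMul.smul_mem h1 hv
        have h3 : (X s : PolyS K n) • v = (X (Sum.inl s) : PolyA K n m) • v := by
          rw [← algebraMap_smul (PolyA K n m) (X s : PolyS K n) v]
          congr 1
          exact rename_X _ _
        rw [h3]
        refine Submodule.mem_iSup_of_mem (1 + i) ?_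
        simpa using h2
      | zero => simp
      | add a b _ _ ha hb => rw [smul_add]; exact Submodule.add_mem _ ha hb
    intro f u hu
    induction f using MvPolynomial.induction_on generalizing u with
    | C a =>
      have : (C a : PolyS K n) • u = a • u := by
        rw [← MvPolynomial.algebraMap_eq, algebraMap_smul]
      rw [this]; exact Submodule.smul_mem _ _ hu
    | add f g hf hg => rw [add_smul]; exact Submodule.add_mem _ (hf hu) (hg hu)
    | mul_X f s hf => rw [mul_smul]; exact hf (hX s u hu)

/-- The grading of `N_k`: its component of degree `c` is `N_{(c,k)}`. -/
def componentGrading (p : Fin m → ℕ) (𝓝 : ℤ × ℤ → Submodule K N)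
    [SetLike.GradedSMul (gradingA K n p) 𝓝] (k c : ℤ) : Submodule K (component (n := n) p 𝓝 k) :=
  (𝓝 (c, k)).comap ((component (n := n) p 𝓝 k).subtype.restrictScalars K)

end Component

/-! ### Graded free resolutions -/

/-- The grading of the free `S`-module `F = ⨁_b S(-a_b)`: an element of `F` is homogeneous of
degree `c` if its `b`-th coordinate is a homogeneous polynomial of degree `c - a_b` for all `b`. -/
def freeGrading {K : Type*} [Field K] {n r : ℕ} (a : Fin r → ℤ) (c : ℤ) :
    Submodule K (Fin r → PolyS K n) :=
  Submodule.pi Set.univ fun b => gradingS K n (c - a b)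

/-- A resolution `⋯ → F_2 → F_1 → F_0 → M → 0` of a graded `S`-module `M` by finitely generated
graded free `S`-modules `F_l = ⨁_b S(-a_{l,b})`, with `S`-linear maps of degree `0`. -/
structure GradedFreeResolution {K : Type*} [Field K] {n : ℕ} {M : Type*} [AddCommGroup M]
    [Module K M] [Module (PolyS K n) M] (𝓜 : ℤ → Submodule K M) where
  /-- the rank of `F_l` -/
  rank : ℕ → ℕ
  /-- the degrees of the basis elements of `F_l` -/
  shift : ∀ l, Fin (rank l) → ℤ
  /-- the differential `F_{l+1} → F_l` -/
  d : ∀ l, (Fin (rank (l + 1)) → PolyS K n) →ₗ[PolyS K n] (Fin (rank l) → PolyS K n)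
  /-- the augmentation `F_0 → M` -/
  aug : (Fin (rank 0) → PolyS K n) →ₗ[PolyS K n] M
  d_degree : ∀ l c, ∀ f ∈ freeGrading (K := K) (shift (l + 1)) c, d l f ∈ freeGrading (shift l) c
  aug_degree : ∀ c, ∀ f ∈ freeGrading (K := K) (shift 0) c, aug f ∈ 𝓜 c
  exact : ∀ l, Function.Exact (d (l + 1)) (d l)
  exact_aug : Function.Exact (d 0) aug
  aug_surjective : Function.Surjective aug

namespace GradedFreeResolution

variable {K : Type*} [Field K] {n : ℕ} {M : Type*} [AddCommGroup M]
    [Module K M] [Module (PolyS K n) M] {𝓜 : ℤ → Submodule K M}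

/-- The `l`-th module `F_l` of the resolution. -/
abbrev obj (F : GradedFreeResolution (n := n) 𝓜) (l : ℕ) : Type _ := Fin (F.rank l) → PolyS K n

/-- The differential that leaves `F_l`: it is `F_{l} → F_{l-1}` for `l > 0`, and zero for
`l = 0` (whatever its target). -/
def out (F : GradedFreeResolution (n := n) 𝓜) :
    ∀ l : ℕ, F.obj l →ₗ[PolyS K n] F.obj (l - 1)
  | 0 => 0
  | l + 1 => F.d l

end GradedFreeResolution

/-! ### Every finitely generated graded `S`-module has a graded free resolution -/

section Existence

variable {K : Type*} [Field K] {n : ℕ}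

theorem mem_freeGrading {r : ℕ} {a : Fin r → ℤ} {c : ℤ} {f : Fin r → PolyS K n} :
    f ∈ freeGrading a c ↔ ∀ b, f b ∈ gradingS K n (c - a b) := by
  simp [freeGrading, Submodule.mem_pi]

instance freeGrading_gradedSMul {r : ℕ} (a : Fin r → ℤ) :
    SetLike.GradedSMul (gradingS K n) (freeGrading (K := K) (n := n) a) where
  smul_mem {i j f g} hf hg := by
    rw [mem_freeGrading] at hg ⊢
    intro b
    have h : (i +ᵥ j) - a b = i + (j - a b) := by rw [vadd_eq_add]; ring
    rw [h]
    exact IsWeightedHomogeneous.mul hf (hg b)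

theorem exists_cover {M : Type*} [AddCommGroup M] [Module K M] [Module (PolyS K n) M]
    (𝓜 : ℤ → Submodule K M) [SetLike.GradedSMul (gradingS K n) 𝓜]
    (U : Submodule (PolyS K n) M) (hfg : U.FG)
    (hU : U = Submodule.span (PolyS K n) {u | u ∈ U ∧ ∃ c, u ∈ 𝓜 c}) :
    ∃ (r : ℕ) (a : Fin r → ℤ) (φ : (Fin r → PolyS K n) →ₗ[PolyS K n] M),
      LinearMap.range φ = U ∧ ∀ c, ∀ f ∈ freeGrading (K := K) a c, φ f ∈ 𝓜 c := by
  rw [hU, Submodule.fg_span_iff_fg_span_finset_subset] at hfg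
  obtain ⟨t, ht, hspan⟩ := hfg
  have hdeg : ∀ b : Fin t.card, ∃ c, ((t.equivFin.symm b : t) : M) ∈ 𝓜 c :=
    fun b => (ht (t.equivFin.symm b).2).2
  choose a ha using hdeg
  refine ⟨t.card, a, Fintype.linearCombination (PolyS K n)
    (fun b => ((t.equivFin.symm b : t) : M)), ?_, ?_⟩
  · rw [Fintype.range_linearCombination, hU, hspan]
    congr 1
    ext u
    constructor
    · rintro ⟨b, rfl⟩; exact (t.equivFin.symm b).2
    · intro hu; exact ⟨t.equivFin ⟨u, hu⟩, by simp⟩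
  · intro c f hf
    rw [Fintype.linearCombination_apply]
    refine Submodule.sum_mem _ fun b _ => ?_
    have h := SetLike.GradedSMul.smul_mem (mem_freeGrading.1 hf b) (ha b)
    rwa [vadd_eq_add, sub_add_cancel] at h

/-- Homogeneous elements of different degrees are independent. -/
def HomogIndep {M : Type*} [AddCommGroup M] [Module K M] (𝓜 : ℤ → Submodule K M) : Prop :=
  ∀ (s : Finset ℤ) (u : ℤ → M), (∀ c, u c ∈ 𝓜 c) → ∑ c ∈ s, u c = 0 → ∀ c ∈ s, u c = 0

theorem indep_of_decomposition {M : Type*} [AddCommGroup M] [Module K M]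
    (𝓜 : ℤ → Submodule K M) [DirectSum.Decomposition 𝓜] : HomogIndep 𝓜 := by
  intro s u hu hs c hc
  let π : M →+ M := ((𝓜 c).subtype.toAddMonoidHom.comp
    (DFinsupp.evalAddMonoidHom c)).comp (DirectSum.decomposeAddEquiv 𝓜).toAddMonoidHom
  have hπ : ∀ z, π z = (DirectSum.decompose 𝓜 z c : 𝓜 c) := fun z => rfl
  have h := congrArg π hs
  rw [map_sum, map_zero, Finset.sum_eq_single c] at h
  · rwa [hπ, DirectSum.decompose_of_mem_same 𝓜 (hu c)] at h
  · intro e _ he; rw [hπ]; exact DirectSum.decompose_of_mem_ne 𝓜 (hu e) he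
  · intro h'; exact absurd hc h'

theorem indep_freeGrading {r : ℕ} (a : Fin r → ℤ) : HomogIndep (freeGrading (K := K) (n := n) a) := by
  intro s u hu hs c hc
  funext b
  ext d
  by_contra hd
  rw [Pi.zero_apply, coeff_zero] at hd
  have h := congrArg (fun f => coeff d (f b)) hs
  simp only [Finset.sum_apply, coeff_sum, Pi.zero_apply, coeff_zero] at h
  rw [Finset.sum_eq_single c] at h
  · exact hd h
  · intro e _ he
    by_contra hd'
    have h1 := mem_freeGrading.1 (hu c) b hd
    have h2 := mem_freeGrading.1 (hu e) b hd'
    omega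
  · intro h'; exact absurd hc h'

theorem ker_eq_span {r : ℕ} (a : Fin r → ℤ) {M : Type*} [AddCommGroup M] [Module K M]
    [Module (PolyS K n) M] (𝓜 : ℤ → Submodule K M) (h𝓜 : HomogIndep 𝓜)
    (φ : (Fin r → PolyS K n) →ₗ[PolyS K n] M)
    (hφ : ∀ c, ∀ f ∈ freeGrading (K := K) a c, φ f ∈ 𝓜 c) :
    LinearMap.ker φ = Submodule.span (PolyS K n)
      {u | u ∈ LinearMap.ker φ ∧ ∃ c, u ∈ freeGrading (K := K) a c} := by
  classical
  refine le_antisymm (fun f hf => ?_) (Submodule.span_le.2 fun u hu => hu.1)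
  let w : Fin n → ℤ := fun _ => 1
  let g : ℤ → (Fin r → PolyS K n) := fun c b => weightedHomogeneousComponent w (c - a b) (f b)
  let s : Finset ℤ := Finset.univ.biUnion fun b =>
    (f b).support.image fun d => Finsupp.weight w d + a b
  have hg : ∀ c, g c ∈ freeGrading (K := K) a c := fun c =>
    mem_freeGrading.2 fun b => weightedHomogeneousComponent_isWeightedHomogeneous _ _
  have hsum : ∑ c ∈ s, g c = f := by
    funext b
    ext d
    simp only [Finset.sum_apply, coeff_sum, g, coeff_weightedHomogeneousComponent]
    by_cases hd : coeff d (f b) = 0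
    · simp [hd]
    · rw [Finset.sum_eq_single (Finsupp.weight w d + a b)]
      · simp
      · intro c _ hc
        rw [if_neg]
        intro h
        apply hc
        omega
      · intro h
        refine absurd ?_ h
        simp only [s, Finset.mem_biUnion, Finset.mem_univ, true_and, Finset.mem_image]
        exact ⟨b, d, mem_support_iff.2 hd, rfl⟩
  have hker : ∀ c ∈ s, φ (g c) = 0 :=
    h𝓜 s (fun c => φ (g c)) (fun c => hφ c _ (hg c)) (by
      rw [← map_sum, hsum]; exact hf)
  rw [← hsum]
  exact Submodule.sum_mem _ fun c hc => Submodule.subset_span ⟨hker c hc, c, hg c⟩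

/-- Degree-preserving maps `⨁_b S(-a₁_b) → ⨁_b S(-a₀_b)` of finite graded free modules. -/
structure FreeMap (K : Type*) [Field K] (n : ℕ) where
  r₁ : ℕ
  r₀ : ℕ
  a₁ : Fin r₁ → ℤ
  a₀ : Fin r₀ → ℤ
  φ : (Fin r₁ → PolyS K n) →ₗ[PolyS K n] (Fin r₀ → PolyS K n)
  degree : ∀ c, ∀ f ∈ freeGrading (K := K) a₁ c, φ f ∈ freeGrading a₀ c

theorem FreeMap.exists_next (D : FreeMap K n) :
    ∃ (r : ℕ) (a : Fin r → ℤ) (φ : (Fin r → PolyS K n) →ₗ[PolyS K n] (Fin D.r₁ → PolyS K n)),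
      LinearMap.range φ = LinearMap.ker D.φ ∧
        ∀ c, ∀ f ∈ freeGrading (K := K) a c, φ f ∈ freeGrading D.a₁ c :=
  exists_cover (freeGrading D.a₁) _ (IsNoetherian.noetherian _)
    (ker_eq_span D.a₁ (freeGrading D.a₀) (indep_freeGrading _) D.φ D.degree)

/-- A map onto the kernel of the given one. -/
def FreeMap.next (D : FreeMap K n) : FreeMap K n where
  r₁ := D.exists_next.choose
  r₀ := D.r₁
  a₁ := D.exists_next.choose_spec.choose
  a₀ := D.a₁
  φ := D.exists_next.choose_spec.choose_spec.choose
  degree := D.exists_next.choose_spec.choose_spec.choose_spec.2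

theorem FreeMap.exact_next (D : FreeMap K n) : Function.Exact D.next.φ D.φ :=
  LinearMap.exact_iff.2 D.exists_next.choose_spec.choose_spec.choose_spec.1.symm

/-- The iterated syzygies of the given map. -/
def FreeMap.iter (D : FreeMap K n) : ℕ → FreeMap K n
  | 0 => D
  | l + 1 => (FreeMap.iter D l).next

theorem GradedFreeResolution.nonempty {M : Type*} [AddCommGroup M] [Module K M]
    [Module (PolyS K n) M] [Module.Finite (PolyS K n) M]
    (𝓜 : ℤ → Submodule K M) [DirectSum.Decomposition 𝓜] [SetLike.GradedSMul (gradingS K n) 𝓜] :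
    Nonempty (GradedFreeResolution (n := n) 𝓜) := by
  classical
  obtain ⟨r₀, a₀, ε, hε, hεd⟩ := exists_cover 𝓜 (⊤ : Submodule (PolyS K n) M)
    Module.Finite.fg_top (by
      refine (eq_top_iff.2 fun u _ => ?_).symm
      rw [← DirectSum.sum_support_decompose 𝓜 u]
      exact Submodule.sum_mem _ fun c _ =>
        Submodule.subset_span ⟨trivial, c, (DirectSum.decompose 𝓜 u c).2⟩)
  obtain ⟨r₁, a₁, φ, hφ, hφd⟩ := exists_cover (freeGrading a₀) (LinearMap.ker ε)
    (IsNoetherian.noetherian _) (ker_eq_span a₀ 𝓜 (indep_of_decomposition 𝓜) ε hεd)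
  let D : FreeMap K n := ⟨r₁, r₀, a₁, a₀, φ, hφd⟩
  have h₁ : Function.Exact φ ε := LinearMap.exact_iff.2 hφ.symm
  have h₂ : Function.Surjective ε := LinearMap.range_eq_top.1 hε
  exact ⟨{
    rank := fun l => (D.iter l).r₀
    shift := fun l => (D.iter l).a₀
    d := fun l => (D.iter l).φ
    aug := ε
    d_degree := fun l => (D.iter l).degree
    aug_degree := hεd
    exact := fun l => (D.iter l).exact_next
    exact_aug := h₁
    aug_surjective := h₂ }⟩

end Existence

/-! ### Homology, Tor and Ext -/

section Homology

variable {R : Type*} [CommRing R] {U V W : Type*} [AddCommGroup U] [AddCommGroup V]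
  [AddCommGroup W] [Module R U] [Module R V] [Module R W]

/-- The homology `ker g / im f` at `V` of `U --f--> V --g--> W`. -/
abbrev Homology (f : U →ₗ[R] V) (g : V →ₗ[R] W) : Type _ :=
  LinearMap.ker g ⧸ (LinearMap.range f).submoduleOf (LinearMap.ker g)

/-- The grading of homology induced by a grading of `V`: a class is homogeneous of degree `c`
if it is represented by a cycle which is homogeneous of degree `c`. -/
def homologyGrading {K : Type*} [Field K] [Algebra K R] [Module K V] [IsScalarTower K R V]
    (f : U →ₗ[R] V) (g : V →ₗ[R] W) (𝒱 : ℤ → Submodule K V) (c : ℤ) :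
    Submodule K (Homology f g) :=
  ((𝒱 c).comap ((LinearMap.ker g).subtype.restrictScalars K)).map
    (((LinearMap.range f).submoduleOf (LinearMap.ker g)).mkQ.restrictScalars K)

end Homology

/-- The grading of `U ⊗_S V` for graded `S`-modules `U` and `V`: its component of degree `c` is
spanned over `K` by the `u ⊗ v` with `u ∈ U_{c-k}` and `v ∈ V_k`, for some `k`. -/
def tensorGrading {K : Type*} [Field K] {n : ℕ} {U V : Type*} [AddCommGroup U] [AddCommGroup V]
    [Module K U] [Module (PolyS K n) U] [IsScalarTower K (PolyS K n) U]
    [Module K V] [Module (PolyS K n) V]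
    (𝒰 : ℤ → Submodule K U) (𝒱 : ℤ → Submodule K V) (c : ℤ) :
    Submodule K (U ⊗[PolyS K n] V) :=
  Submodule.span K {z | ∃ k : ℤ, ∃ u ∈ 𝒰 (c - k), ∃ v ∈ 𝒱 k, z = u ⊗ₜ[PolyS K n] v}

/-- The grading of `Hom_S(U, V)` for graded `S`-modules `U` and `V`: `f` is homogeneous of degree
`c` if `f(U_k) ⊆ V_{k+c}` for all `k`. -/
def homGrading {K : Type*} [Field K] {n : ℕ} {U V : Type*} [AddCommGroup U] [AddCommGroup V]
    [Module K U] [Module (PolyS K n) U]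
    [Module K V] [Module (PolyS K n) V] [IsScalarTower K (PolyS K n) V]
    (𝒰 : ℤ → Submodule K U) (𝒱 : ℤ → Submodule K V) (c : ℤ) :
    Submodule K (U →ₗ[PolyS K n] V) where
  carrier := {f | ∀ k : ℤ, ∀ u ∈ 𝒰 k, f u ∈ 𝒱 (k + c)}
  add_mem' hf hg k u hu := Submodule.add_mem _ (hf k u hu) (hg k u hu)
  zero_mem' _ _ _ := Submodule.zero_mem _
  smul_mem' a _ hf k u hu := Submodule.smul_mem _ a (hf k u hu)

section TorExt

variable {K : Type*} [Field K] {n : ℕ} {M : Type*} [AddCommGroup M] [Module K M]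
  [Module (PolyS K n) M] {𝓜 : ℤ → Submodule K M} (F : GradedFreeResolution (n := n) 𝓜)
  (R : Type*) [CommRing R] [Algebra (PolyS K n) R]
  (V : Type*) [AddCommGroup V] [Module (PolyS K n) V] [Module R V] [IsScalarTower (PolyS K n) R V]

/-- The map `V ⊗_S F_{l+1} → V ⊗_S F_l`; it is `R`-linear if `V` is a module over the
`S`-algebra `R`. -/
abbrev torIn (l : ℕ) : V ⊗[PolyS K n] F.obj (l + 1) →ₗ[R] V ⊗[PolyS K n] F.obj l :=
  TensorProduct.AlgebraTensorModule.lTensor R V (F.d l)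

/-- The map `V ⊗_S F_l → V ⊗_S F_{l-1}` (zero if `l = 0`). -/
abbrev torOut (l : ℕ) : V ⊗[PolyS K n] F.obj l →ₗ[R] V ⊗[PolyS K n] F.obj (l - 1) :=
  TensorProduct.AlgebraTensorModule.lTensor R V (F.out l)

/-- `Tor_l^S(M, V) = H_l(F ⊗_S V)`, computed from the graded free resolution `F` of `M`. It is an
`R`-module if `V` is a module over the `S`-algebra `R`. -/
abbrev Tor (l : ℕ) : Type _ := Homology (torIn F R V l) (torOut F R V l)

/-- The map `Hom_S(F_{l-1}, V) → Hom_S(F_l, V)` (zero if `l = 0`). -/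
abbrev extIn (l : ℕ) : (F.obj (l - 1) →ₗ[PolyS K n] V) →ₗ[R] (F.obj l →ₗ[PolyS K n] V) :=
  LinearMap.lcomp R V (F.out l)

/-- The map `Hom_S(F_l, V) → Hom_S(F_{l+1}, V)`. -/
abbrev extOut (l : ℕ) : (F.obj l →ₗ[PolyS K n] V) →ₗ[R] (F.obj (l + 1) →ₗ[PolyS K n] V) :=
  LinearMap.lcomp R V (F.d l)

/-- `Ext^l_S(M, V) = H^l(Hom_S(F, V))`, computed from the graded free resolution `F` of `M`. It is
an `R`-module if `V` is a module over the `S`-algebra `R`. -/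
abbrev Ext (l : ℕ) : Type _ := Homology (extIn F R V l) (extOut F R V l)

variable {V} [Module K V] [IsScalarTower K (PolyS K n) V] (𝒱 : ℤ → Submodule K V)

/-- The grading of `Tor_l^S(M, V)` for a graded `S`-module `V`. -/
def torGrading (l : ℕ) (c : ℤ) : Submodule K (Tor F (PolyS K n) V l) :=
  homologyGrading (torIn F (PolyS K n) V l) (torOut F (PolyS K n) V l)
    (tensorGrading 𝒱 (freeGrading (F.shift l))) c

/-- The grading of `Ext^l_S(M, V)` for a graded `S`-module `V`. -/
def extGrading (l : ℕ) (c : ℤ) : Submodule K (Ext F (PolyS K n) V l) :=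
  homologyGrading (extIn F (PolyS K n) V l) (extOut F (PolyS K n) V l)
    (homGrading (freeGrading (F.shift l)) 𝒱) c

end TorExt

/-- The dimension of the fibre `T / 𝔪T` of an `A`-module `T`. -/
def fibreDim (K : Type*) [Field K] (n m : ℕ) (T : Type*) [AddCommGroup T]
    [Module (PolyA K n m) T] : WithBot ℕ∞ :=
  Module.supportDim (PolyA K n m) (T ⧸ (idealX K n m • (⊤ : Submodule (PolyA K n m) T)))

end BigradedHilbert

end

open BigradedHilbert

/-! The modules `Tor F A N l` and `Ext F A N l` are homologies `Z / B` of complexes of finitely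
generated bigraded `A`-modules, with terms `N ⊗ F_l` or `Hom(F_l, N)`. The slice of `Z / B` in
`y`-degree `k` is Tor or Ext with coefficients in `N_k`. So the theorem is about the Hilbert
functions of the slices of a bigraded subquotient.

The core is the cyclic case `A / I` with `I` homogeneous (`hasPolyCoeffs_hilbQuot`). If `D` bounds
`dim S/(I ∩ S)` and `δ` bounds `dim A/(I + 𝔪)`, then all slices have coefficients with respect to
`D`, and the `j`-th one is, for large `k`, a polynomial in `k` of degree less than `δ + j`. The
proof is Noetherian induction on `I` with the exact sequence `0 → A/(I : z)(-deg z) → A/I → A/(I +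
z) → 0` for a variable `z` outside `I`. If `z` is a zero divisor modulo `I`, both outer ideals are
larger. If `z = x_i` is regular modulo `I`, then `D` drops by one. If `I` contains all `x_i` and `z
= y_t` is regular, then `δ` drops by one. If all variables lie in `I`, the Hilbert function is
supported at the origin.

Two facts about coefficients make the regular cases work. The coefficients of all iterated sums are
initial segments of one sequence (`IterCoeffs`), so undoing a difference in `x` keeps the sequence
(`HasPolyCoeffs.of_diff_fst`). A translation in `x` changes the `j`-th coefficient only by
combinations of earlier ones, whose degree bounds are smaller by at least one. Hence undoing a
difference along `(p_t, 1)` raises each degree bound by only one (`HasPolyCoeffs.of_diff_snd`).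

For general `Z / B`, the annihilators of the slices stabilise at an ideal `J` and the late slices of
`Z` are generated by a single slice (`exists_stable_slice`). This fixes the dimension `D` of the
late slices. A chain of cyclic extensions whose colon ideals contain `J` then reduces to the cyclic
case (`hasPolyCoeffs_of_chain`). Finally, `δ` is the fibre dimension of `Z / B`, and `δ ≤ m` because
`A/𝔪` is a polynomial ring in the `y_t`. -/

/-! ### Iterated summation of functions that vanish far to the left. -/

/-- The summation operator `f ↦ (x ↦ ∑_{t ≤ x} f t)`. -/
noncomputable def sumOp (f : ℤ → ℤ) (x : ℤ) : ℤ := ∑ᶠ t : Set.Iic x, f t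

theorem sumOp_eq {f : ℤ → ℤ} {b : ℤ} (hb : ∀ x < b, f x = 0) (x : ℤ) :
    sumOp f x = ∑ t ∈ Finset.Icc b x, f t := by
  rw [sumOp, finsum_set_coe_eq_finsum_mem]
  refine finsum_mem_eq_sum_of_inter_support_eq f ?_
  ext t
  simp only [Set.mem_inter_iff, Set.mem_Iic, Function.mem_support, Finset.coe_Icc, Set.mem_Icc]
  constructor
  · rintro ⟨h1, h2⟩
    exact ⟨⟨by by_contra h; exact h2 (hb t (by omega)), h1⟩, h2⟩
  · rintro ⟨⟨_, h1⟩, h2⟩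
    exact ⟨h1, h2⟩

theorem sumOp_eq_zero {f : ℤ → ℤ} {b : ℤ} (hb : ∀ x < b, f x = 0) : ∀ x < b, sumOp f x = 0 := by
  intro x hx
  rw [sumOp_eq hb, Finset.Icc_eq_empty (by omega), Finset.sum_empty]

theorem sumOp_sub_sumOp {f : ℤ → ℤ} {b : ℤ} (hb : ∀ x < b, f x = 0) (x : ℤ) :
    sumOp f x - sumOp f (x - 1) = f x := by
  rcases lt_or_ge x b with h | h
  · rw [sumOp_eq_zero hb x h, sumOp_eq_zero hb _ (by omega), hb x h, sub_zero]
  · have : Finset.Icc b x = insert x (Finset.Icc b (x - 1)) := by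
      ext t; simp only [Finset.mem_Icc, Finset.mem_insert]; omega
    rw [sumOp_eq hb, sumOp_eq hb, this, Finset.sum_insert (by simp), add_sub_cancel_right]

theorem eq_of_backward_diff {F G : ℤ → ℤ} {b : ℤ} (hF : ∀ x < b, F x = 0) (hG : ∀ x < b, G x = 0)
    (h : ∀ x, F x - F (x - 1) = G x - G (x - 1)) : F = G := by
  funext x
  rcases lt_or_ge x b with hx | hx
  · rw [hF x hx, hG x hx]
  · induction x, hx using Int.leInduction with
    | base =>
      have := h b
      rw [hF _ (by omega : b - 1 < b), hG _ (by omega : b - 1 < b)] at this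
      simpa using this
    | succ x hx ih =>
      have := h (x + 1)
      rw [add_sub_cancel_right, ih] at this
      linarith

/-- Among functions vanishing far to the left, summation is the only inverse of the backward
difference. Identities for `sumOp` are therefore checked after taking differences. -/
theorem sumOp_unique {f G : ℤ → ℤ} {b : ℤ} (hb : ∀ x < b, f x = 0) (hG : ∀ x < b, G x = 0)
    (h : ∀ x, G x - G (x - 1) = f x) : sumOp f = G :=
  eq_of_backward_diff (sumOp_eq_zero hb) hG fun x => by rw [sumOp_sub_sumOp hb, h]

theorem iterate_sumOp_eq_zero {f : ℤ → ℤ} {b : ℤ} (hb : ∀ x < b, f x = 0) (i : ℕ) :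
    ∀ x < b, sumOp^[i] f x = 0 := by
  induction i with
  | zero => simpa using hb
  | succ i ih => rw [Function.iterate_succ_apply']; exact sumOp_eq_zero ih

theorem iterate_sumOp_add {f g : ℤ → ℤ} {b : ℤ} (hf : ∀ x < b, f x = 0) (hg : ∀ x < b, g x = 0)
    (i : ℕ) : sumOp^[i] (f + g) = sumOp^[i] f + sumOp^[i] g := by
  induction i with
  | zero => rfl
  | succ i ih =>
    have h1 := iterate_sumOp_eq_zero hf i
    have h2 := iterate_sumOp_eq_zero hg i
    rw [Function.iterate_succ_apply', Function.iterate_succ_apply', Function.iterate_succ_apply',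
      ih]
    refine sumOp_unique (b := b) (fun x hx => ?_) (fun x hx => ?_) fun x => ?_
    · simp [h1 x hx, h2 x hx]
    · simp [sumOp_eq_zero h1 x hx, sumOp_eq_zero h2 x hx]
    · have e1 := sumOp_sub_sumOp h1 x
      have e2 := sumOp_sub_sumOp h2 x
      simp only [Pi.add_apply]
      linarith

theorem iterate_sumOp_translate {f : ℤ → ℤ} {b : ℤ} (hf : ∀ x < b, f x = 0) (a : ℤ) (i : ℕ) :
    sumOp^[i] (fun x => f (x - a)) = fun x => sumOp^[i] f (x - a) := by
  induction i with
  | zero => rfl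
  | succ i ih =>
    have h1 := iterate_sumOp_eq_zero hf i
    rw [Function.iterate_succ_apply', Function.iterate_succ_apply', ih]
    refine sumOp_unique (b := b + a) (fun x hx => ?_) (fun x hx => ?_) fun x => ?_
    · exact h1 _ (by omega)
    · exact sumOp_eq_zero h1 _ (by omega)
    · rw [sub_right_comm, sumOp_sub_sumOp h1]

/-! ### Binomial expansions -/

/-- Pascal's rule lowers each binomial by one, and the constant term `j = r` cancels. The indexing
by `j` is chosen so that the remaining coefficients keep their places. -/
theorem binomExpansion_sub (r : ℕ) (c : ℕ → ℤ) (x : ℤ) :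
    binomExpansion (r + 1) c x - binomExpansion (r + 1) c (x - 1) = binomExpansion r c x := by
  rw [binomExpansion, binomExpansion, binomExpansion, Finset.sum_range_succ,
    Finset.sum_range_succ]
  simp only [Nat.add_sub_cancel, Nat.sub_self, Ring.choose_zero_right]
  rw [add_sub_add_right_eq_sub, ← Finset.sum_sub_distrib]
  refine Finset.sum_congr rfl fun j hj => ?_
  have hj := Finset.mem_range.1 hj
  obtain ⟨t, ht⟩ : ∃ t, r = j + t + 1 := ⟨r - j - 1, by omega⟩
  have e1 : r - j = t + 1 := by omega
  have e2 : r - 1 - j = t := by omega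
  rw [e1, e2]
  have h : x + ((t + 1 : ℕ) : ℤ) = (x + (t : ℤ)) + 1 := by push_cast; ring
  have h' : x - 1 + ((t + 1 : ℕ) : ℤ) = x + (t : ℤ) := by push_cast; ring
  rw [h, h', Ring.choose_succ_succ]; ring

/-- The effect of the translation `f(x) ↦ f(x - 1)` on coefficients. -/
def shiftCoeffs (c : ℕ → ℤ) : ℕ → ℤ
  | 0 => c 0
  | j + 1 => c (j + 1) + c j

/-- The effect of the translation `f(x) ↦ f(x + 1)` on coefficients. -/
def unshiftCoeffs (c : ℕ → ℤ) : ℕ → ℤ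
  | 0 => c 0
  | j + 1 => c (j + 1) - unshiftCoeffs c j

theorem shiftCoeffs_unshiftCoeffs (c : ℕ → ℤ) : shiftCoeffs (unshiftCoeffs c) = c := by
  funext j
  cases j <;> simp [shiftCoeffs, unshiftCoeffs]

theorem binomExpansion_add (r : ℕ) (c e : ℕ → ℤ) (x : ℤ) :
    binomExpansion r (c + e) x = binomExpansion r c x + binomExpansion r e x := by
  simp only [binomExpansion, ← Finset.sum_add_distrib, Pi.add_apply]
  exact Finset.sum_congr rfl fun _ _ => by ring

theorem binomExpansion_zero (r : ℕ) (x : ℤ) : binomExpansion r 0 x = 0 := by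
  simp [binomExpansion]

theorem binomExpansion_congr {r : ℕ} {c e : ℕ → ℤ} (h : ∀ j < r, c j = e j) (x : ℤ) :
    binomExpansion r c x = binomExpansion r e x :=
  Finset.sum_congr rfl fun j hj => by rw [h j (Finset.mem_range.1 hj)]

/-- Write `f(x - 1)` as `f(x)` minus the backward difference of `f`. The difference has one term
fewer, so against `r` terms its `j`-th coefficient is counted at place `j + 1`, with the opposite
sign. -/
theorem binomExpansion_shiftCoeffs (r : ℕ) (c : ℕ → ℤ) (x : ℤ) :
    binomExpansion r (shiftCoeffs c) x = binomExpansion r c (x - 1) := by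
  rcases r with _ | r
  · simp [binomExpansion]
  · have h := binomExpansion_sub r c x
    have h2 : binomExpansion (r + 1) (shiftCoeffs c) x =
        binomExpansion (r + 1) c x - binomExpansion r c x := by
      simp only [binomExpansion]
      rw [Finset.sum_range_succ', Finset.sum_range_succ' _ r, add_sub_right_comm,
        ← Finset.sum_sub_distrib]
      congr 1
      refine Finset.sum_congr rfl fun j hj => ?_
      have hj := Finset.mem_range.1 hj
      have e : r + 1 - 1 - (j + 1) = r - 1 - j := by omega
      rw [e, shiftCoeffs]; ring
    rw [h2, ← h]; ring

/-! ### Iterated coefficients -/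

/-- The function `f` vanishes for `x ≪ 0`, and for all `i` its `i`-fold sum is, for `x ≫ 0`, given
by the binomial expansion with `D + i` terms and coefficients `c`. -/
def IterCoeffs (f : ℤ → ℤ) (D : ℕ) (c : ℕ → ℤ) : Prop :=
  (∃ b, ∀ x < b, f x = 0) ∧
    ∀ i, ∀ᶠ x : ℤ in atTop, sumOp^[i] f x = binomExpansion (D + i) c x

namespace IterCoeffs

variable {f g : ℤ → ℤ} {D : ℕ} {c e : ℕ → ℤ}

theorem zero (D : ℕ) : IterCoeffs 0 D 0 := by
  refine ⟨⟨0, fun _ _ => rfl⟩, fun i => Eventually.of_forall fun x => ?_⟩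
  rw [binomExpansion_zero]
  exact iterate_sumOp_eq_zero (b := x + 1) (fun _ _ => rfl) i x (by omega)

theorem add (hf : IterCoeffs f D c) (hg : IterCoeffs g D e) : IterCoeffs (f + g) D (c + e) := by
  obtain ⟨⟨b, hb⟩, hf⟩ := hf
  obtain ⟨⟨b', hb'⟩, hg⟩ := hg
  have h1 : ∀ x < min b b', f x = 0 := fun x hx => hb x (by omega)
  have h2 : ∀ x < min b b', g x = 0 := fun x hx => hb' x (by omega)
  refine ⟨⟨min b b', fun x hx => by simp [h1 x hx, h2 x hx]⟩, fun i => ?_⟩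
  filter_upwards [hf i, hg i] with x e1 e2
  rw [iterate_sumOp_add h1 h2, Pi.add_apply, e1, e2, binomExpansion_add]

theorem translate_one (hf : IterCoeffs f D c) :
    IterCoeffs (fun x => f (x - 1)) D (shiftCoeffs c) := by
  obtain ⟨⟨b, hb⟩, hf⟩ := hf
  refine ⟨⟨b, fun x hx => hb _ (by omega)⟩, fun i => ?_⟩
  filter_upwards [(tendsto_atTop_add_const_right atTop (-1 : ℤ) tendsto_id).eventually (hf i)]
    with x hx
  rw [iterate_sumOp_translate hb, binomExpansion_shiftCoeffs]
  exact hx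

theorem translate_neg_one (hf : IterCoeffs f D c) :
    IterCoeffs (fun x => f (x + 1)) D (unshiftCoeffs c) := by
  obtain ⟨⟨b, hb⟩, hf⟩ := hf
  refine ⟨⟨b - 1, fun x hx => hb _ (by omega)⟩, fun i => ?_⟩
  filter_upwards [(tendsto_atTop_add_const_right atTop (1 : ℤ) tendsto_id).eventually (hf i)]
    with x hx
  have := congrFun (iterate_sumOp_translate hb (-1) i) x
  simp only [sub_neg_eq_add] at this
  rw [this]
  refine hx.trans ?_
  conv_lhs => rw [← shiftCoeffs_unshiftCoeffs c]
  rw [binomExpansion_shiftCoeffs]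
  simp

theorem translate (hf : IterCoeffs f D c) (a : ℕ) :
    IterCoeffs (fun x => f (x - a)) D (shiftCoeffs^[a] c) := by
  induction a with
  | zero => simpa using hf
  | succ a ih =>
    rw [Function.iterate_succ_apply']
    convert ih.translate_one using 3
    push_cast; ring

/-- Here `f` is the sum of `g`, so the `i`-fold sum of `f` is the `(i + 1)`-fold sum of `g`. The
coefficients are unchanged. -/
theorem of_diff {b : ℤ} (hb : ∀ x < b, f x = 0) (hg : IterCoeffs g D c)
    (h : ∀ x, f x - f (x - 1) = g x) : IterCoeffs f (D + 1) c := by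
  have hb' : ∀ x < b, g x = 0 := fun x hx => by
    rw [← h, hb x hx, hb _ (by omega), sub_zero]
  refine ⟨⟨b, hb⟩, fun i => ?_⟩
  have := hg.2 (i + 1)
  rw [Function.iterate_succ_apply, sumOp_unique hb' hb h] at this
  rw [add_assoc, add_comm 1 i]
  exact this

end IterCoeffs

/-- Each summation keeps the coefficients already found and appends a constant of summation as the
last one. The sequence `c` collects these constants. -/
theorem exists_iterCoeffs {f : ℤ → ℤ} {b : ℤ} (hb : ∀ x < b, f x = 0) {D : ℕ} {c₀ : ℕ → ℤ}
    (h : ∀ᶠ x : ℤ in atTop, f x = binomExpansion D c₀ x) : ∃ c, IterCoeffs f D c := by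
  have step : ∀ (g : ℤ → ℤ) (r : ℕ) (c : ℕ → ℤ), (∀ x < b, g x = 0) →
      (∀ᶠ x : ℤ in atTop, g x = binomExpansion r c x) →
      ∃ a : ℤ, ∀ᶠ x : ℤ in atTop,
        sumOp g x = binomExpansion (r + 1) (fun j => if j < r then c j else a) x := by
    intro g r c hg h
    obtain ⟨x₀, hx₀⟩ := eventually_atTop.1 h
    -- From `x₀` on, both terms of `E` have the same backward difference, so `E` is constant there.
    -- Its value is the missing constant of summation, up to the sign `(-1) ^ r` carried by the last
    -- term.
    let E : ℤ → ℤ := fun x => sumOp g x - binomExpansion (r + 1) (fun j => if j < r then c j else 0) x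
    have hE : ∀ x ≥ x₀, E x = E x₀ := by
      intro x hx
      induction x, hx using Int.leInduction with
      | base => rfl
      | succ x hx ih =>
        have e1 := sumOp_sub_sumOp hg (x + 1)
        have e2 := binomExpansion_sub r (fun j => if j < r then c j else 0) (x + 1)
        rw [hx₀ _ (by omega)] at e1
        rw [binomExpansion_congr (r := r) (e := c) (fun j hj => by simp [hj])] at e2
        rw [add_sub_cancel_right] at e1 e2
        simp only [E] at ih ⊢
        linarith
    refine ⟨(-1) ^ r * E x₀, eventually_atTop.2 ⟨x₀, fun x hx => ?_⟩⟩
    have h1 := hE x hx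
    have h2 : ∀ a : ℤ, binomExpansion (r + 1) (fun j => if j < r then c j else a) x =
        binomExpansion r c x - binomExpansion r c x +
          (∑ j ∈ Finset.range r, (-1) ^ j * c j *
            Ring.choose (x + ((r - j : ℕ) : ℤ)) (r - j) + (-1) ^ r * a) := by
      intro a
      rw [binomExpansion, Finset.sum_range_succ]
      simp only [lt_self_iff_false, if_false, Nat.add_sub_cancel, Nat.sub_self,
        Ring.choose_zero_right, mul_one, sub_self, zero_add]
      congr 1
      refine Finset.sum_congr rfl fun j hj => ?_
      rw [if_pos (Finset.mem_range.1 hj)]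
    have h3 : ((-1 : ℤ) ^ r) * (-1) ^ r = 1 := by rw [← mul_pow]; simp
    have h4 := h2 ((-1) ^ r * E x₀)
    have h5 := h2 0
    rw [h4, ← mul_assoc, h3]
    simp only [E] at h1 ⊢
    linarith
  choose! A hA using step
  let s : ℕ → (ℕ → ℤ) := fun i => Nat.rec c₀
    (fun i c j => if j < D + i then c j else A (sumOp^[i] f) (D + i) c) i
  have hs : ∀ i, s (i + 1) = fun j => if j < D + i then s i j else A (sumOp^[i] f) (D + i) (s i) :=
    fun i => rfl
  have h1 : ∀ i, ∀ᶠ x : ℤ in atTop, sumOp^[i] f x = binomExpansion (D + i) (s i) x := by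
    intro i
    induction i with
    | zero => exact h
    | succ i ih =>
      rw [Function.iterate_succ_apply', hs]
      exact hA _ _ _ (iterate_sumOp_eq_zero hb i) ih
  have h2 : ∀ i t j, j < D + i → s (i + t) j = s i j := by
    intro i t j hj
    induction t with
    | zero => rfl
    | succ t ih => rw [← add_assoc, hs]; simp only; rw [if_pos (by omega), ih]
  -- The `j`-th entry is final once `j < D + i`, which holds at stage `i = j + 1` even for `D = 0`.
  -- So the diagonal agrees with every `s i` on its relevant range.
  refine ⟨fun j => s (j + 1) j, ⟨b, hb⟩, fun i => ?_⟩
  filter_upwards [h1 i] with x hx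
  rw [hx]
  refine binomExpansion_congr (fun j hj => ?_) x
  rcases le_total i (j + 1) with h | h
  · obtain ⟨t, ht⟩ := Nat.exists_eq_add_of_le h
    rw [ht, h2 i t j hj]
  · obtain ⟨t, ht⟩ := Nat.exists_eq_add_of_le h
    rw [ht, h2 (j + 1) t j (by omega)]

/-! ### Sequences that are eventually polynomial -/

/-- For `k ≫ 0`, `a k` is the value of a rational polynomial of degree less than `s`. -/
def EventuallyPoly (s : ℕ) (a : ℤ → ℤ) : Prop :=
  ∃ q ∈ Polynomial.degreeLT ℚ s, ∀ᶠ k : ℤ in atTop, (a k : ℚ) = q.eval (k : ℚ)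

namespace EventuallyPoly

variable {s t : ℕ} {a b : ℤ → ℤ}

theorem zero (s : ℕ) : EventuallyPoly s 0 :=
  ⟨0, Submodule.zero_mem _, Eventually.of_forall fun _ => by simp⟩

theorem mono (h : s ≤ t) (ha : EventuallyPoly s a) : EventuallyPoly t a := by
  obtain ⟨q, hq, h'⟩ := ha
  exact ⟨q, Polynomial.degreeLT_mono h hq, h'⟩

theorem congr (ha : EventuallyPoly s a) (h : ∀ᶠ k : ℤ in atTop, b k = a k) :
    EventuallyPoly s b := by
  obtain ⟨q, hq, h'⟩ := ha
  refine ⟨q, hq, ?_⟩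
  filter_upwards [h, h'] with k e1 e2
  rw [e1, e2]

theorem add (ha : EventuallyPoly s a) (hb : EventuallyPoly s b) : EventuallyPoly s (a + b) := by
  obtain ⟨q, hq, h⟩ := ha
  obtain ⟨q', hq', h'⟩ := hb
  refine ⟨q + q', Submodule.add_mem _ hq hq', ?_⟩
  filter_upwards [h, h'] with k e1 e2
  simp [e1, e2]

theorem sub (ha : EventuallyPoly s a) (hb : EventuallyPoly s b) : EventuallyPoly s (a - b) := by
  obtain ⟨q, hq, h⟩ := ha
  obtain ⟨q', hq', h'⟩ := hb
  refine ⟨q - q', Submodule.sub_mem _ hq hq', ?_⟩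
  filter_upwards [h, h'] with k e1 e2
  simp [e1, e2]

theorem mem_degreeLT_succ {q : Polynomial ℚ} :
    q ∈ Polynomial.degreeLT ℚ (s + 1) ↔ q.natDegree ≤ s := by
  rw [Polynomial.degreeLT_succ_eq_degreeLE, Polynomial.mem_degreeLE,
    Polynomial.natDegree_le_iff_degree_le]

theorem translate (ha : EventuallyPoly s a) (e : ℤ) : EventuallyPoly s fun k => a (k - e) := by
  obtain ⟨q, hq, h⟩ := ha
  refine ⟨q.comp (Polynomial.X - Polynomial.C (e : ℚ)), ?_, ?_⟩
  · rcases s with _ | s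
    · have : q = 0 := Polynomial.ext (by simpa [Polynomial.degreeLT] using hq)
      simp [this]
    · rw [mem_degreeLT_succ] at *
      refine Polynomial.natDegree_comp_le.trans ?_
      rw [Polynomial.natDegree_X_sub_C, mul_one]
      exact hq
  · filter_upwards [(tendsto_atTop_add_const_right atTop (-e : ℤ) tendsto_id).eventually h]
      with k hk
    simpa [sub_eq_add_neg] using hk

/-- A polynomial of degree less than `s` is the backward difference of one of degree less than `s +
1`. Subtracting the latter leaves a sequence that is eventually constant. -/
theorem of_diff (h : EventuallyPoly s fun k => a k - a (k - 1)) : EventuallyPoly (s + 1) a := by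
  obtain ⟨q, hq, h⟩ := h
  obtain ⟨Q, hQ, hQq⟩ : ∃ Q ∈ Polynomial.degreeLT ℚ (s + 1), ∀ k : ℚ,
      Q.eval k - Q.eval (k - 1) = q.eval k := by
    clear h
    rw [Polynomial.degreeLT_eq_span_X_pow] at hq
    induction hq using Submodule.span_induction with
    | mem q hq =>
      simp only [Finset.coe_image, Finset.coe_range, Set.mem_image, Set.mem_Iio] at hq
      obtain ⟨i, hi, rfl⟩ := hq
      -- The identity `B_{i+1}(k + 1) - B_{i+1}(k) = (i + 1) k^i` for Bernoulli polynomials solves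
      -- the difference equation for a monomial.
      refine ⟨Polynomial.C ((i + 1 : ℚ)⁻¹) * (Polynomial.bernoulli (i + 1)).comp
        (Polynomial.X + Polynomial.C 1), ?_, fun k => ?_⟩
      · rw [mem_degreeLT_succ]
        refine (Polynomial.natDegree_C_mul_le _ _).trans
          (Polynomial.natDegree_comp_le.trans ?_)
        rw [Polynomial.natDegree_X_add_C, mul_one]
        have : (Polynomial.bernoulli (i + 1)).natDegree ≤ i + 1 := by
          rw [Polynomial.bernoulli_def]
          refine Polynomial.natDegree_sum_le_of_forall_le _ _ fun j hj => ?_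
          exact (Polynomial.natDegree_monomial_le _).trans
            (Nat.lt_succ_iff.1 (Finset.mem_range.1 hj))
        omega
      · have := Polynomial.bernoulli_eval_one_add (i + 1) k
        simp only [Polynomial.eval_mul, Polynomial.eval_C, Polynomial.eval_comp,
          Polynomial.eval_add, Polynomial.eval_X, Polynomial.eval_pow, sub_add_cancel]
        rw [add_comm k 1, this, Nat.add_sub_cancel]
        push_cast
        have : (i + 1 : ℚ) ≠ 0 := by positivity
        field_simp
        simp
    | zero => exact ⟨0, Submodule.zero_mem _, by simp⟩
    | add q q' _ _ h h' =>
      obtain ⟨Q, hQ, h⟩ := h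
      obtain ⟨Q', hQ', h'⟩ := h'
      refine ⟨Q + Q', Submodule.add_mem _ hQ hQ', fun k => ?_⟩
      rw [Polynomial.eval_add, Polynomial.eval_add, Polynomial.eval_add, ← h, ← h']; ring
    | smul r q _ h =>
      obtain ⟨Q, hQ, h⟩ := h
      refine ⟨r • Q, Submodule.smul_mem _ r hQ, fun k => ?_⟩
      rw [Polynomial.eval_smul, Polynomial.eval_smul, Polynomial.eval_smul, ← h, smul_sub]
  obtain ⟨k₀, hk₀⟩ := eventually_atTop.1 h
  refine ⟨Q + Polynomial.C (a k₀ - Q.eval (k₀ : ℚ)), Submodule.add_mem _ hQ ?_,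
    eventually_atTop.2 ⟨k₀, fun k hk => ?_⟩⟩
  · rw [mem_degreeLT_succ, Polynomial.natDegree_C]
    exact Nat.zero_le _
  · induction k, hk using Int.leInduction with
    | base => simp
    | succ k hk ih =>
      have e1 := hk₀ (k + 1) (by omega)
      simp only [add_sub_cancel_right] at e1
      have e2 := hQq ((k + 1 : ℤ) : ℚ)
      have : (((k + 1 : ℤ) : ℚ) - 1) = (k : ℚ) := by push_cast; ring
      rw [this] at e2
      push_cast at e1 e2 ih ⊢
      simp only [Polynomial.eval_add, Polynomial.eval_C] at ih ⊢
      linarith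

end EventuallyPoly

/-! ### Functions of two variables with eventually polynomial coefficients -/

/-- The functions `x ↦ f (x, k)` have iterated coefficients `c k j` (with respect to `D`), and
`k ↦ c k j` is eventually a polynomial of degree less than `δ + j`. -/
def HasPolyCoeffs (D δ : ℕ) (f : ℤ × ℤ → ℤ) : Prop :=
  ∃ c : ℤ → ℕ → ℤ, (∀ k, IterCoeffs (fun x => f (x, k)) D (c k)) ∧
    ∀ j, EventuallyPoly (δ + j) fun k => c k j

namespace HasPolyCoeffs

variable {D δ : ℕ} {f g : ℤ × ℤ → ℤ}

theorem zero (D δ : ℕ) : HasPolyCoeffs D δ 0 :=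
  ⟨0, fun _ => IterCoeffs.zero D, fun _ => EventuallyPoly.zero _⟩

theorem add (hf : HasPolyCoeffs D δ f) (hg : HasPolyCoeffs D δ g) : HasPolyCoeffs D δ (f + g) := by
  obtain ⟨c, hc, hc'⟩ := hf
  obtain ⟨e, he, he'⟩ := hg
  exact ⟨c + e, fun k => (hc k).add (he k), fun j => (hc' j).add (he' j)⟩

/-- A shift in `k` only translates the polynomials. A unit shift in `x` adds or subtracts
coefficients with smaller index, which satisfy stronger degree bounds. -/
theorem translate (hf : HasPolyCoeffs D δ f) (e : ℤ × ℤ) :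
    HasPolyCoeffs D δ fun v => f (v - e) := by
  obtain ⟨a, b⟩ := e
  have h1 : HasPolyCoeffs D δ fun v => f (v - (0, b)) := by
    obtain ⟨c, hc, hc'⟩ := hf
    refine ⟨fun k => c (k - b), fun k => ?_, fun j => (hc' j).translate b⟩
    simpa using hc (k - b)
  induction a using Int.induction_on with
  | zero => exact h1
  | succ a ih =>
    obtain ⟨c, hc, hc'⟩ := ih
    refine ⟨fun k => shiftCoeffs (c k), fun k => ?_, fun j => ?_⟩
    · convert (hc k).translate_one using 1
      funext x
      simp only [Prod.mk_sub_mk]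
      congr 2
      ring
    · rcases j with _ | j
      · exact hc' 0
      · exact (hc' (j + 1)).add ((hc' j).mono (by omega))
  | pred a ih =>
    obtain ⟨c, hc, hc'⟩ := ih
    refine ⟨fun k => unshiftCoeffs (c k), fun k => ?_, fun j => ?_⟩
    · convert (hc k).translate_neg_one using 1
      funext x
      simp only [Prod.mk_sub_mk]
      congr 2
      ring
    · induction j with
      | zero => exact hc' 0
      | succ j ihj => exact (hc' (j + 1)).sub (ihj.mono (by omega))

theorem of_diff_fst (hb : ∀ k, ∃ b, ∀ x < b, f (x, k) = 0) (hg : HasPolyCoeffs D δ g)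
    (h : ∀ x k, f (x, k) - f (x - 1, k) = g (x, k)) : HasPolyCoeffs (D + 1) δ f := by
  obtain ⟨c, hc, hc'⟩ := hg
  refine ⟨c, fun k => ?_, hc'⟩
  obtain ⟨b, hb⟩ := hb k
  exact (hc k).of_diff hb fun x => h x k

/-- The coefficients of `f` solve the recursion `e k = c k + shiftCoeffs^[p] (e (k - 1))`, started
from zero for `k < 0`. Modulo earlier coefficients, this says that the difference of the `j`-th
coefficient is `c k j`. By strong induction on `j` those earlier coefficients have degree less than
`δ + j`, so `EventuallyPoly.of_diff` costs one degree. -/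
theorem of_diff_snd (hb : ∀ k < 0, ∀ x, f (x, k) = 0) (hg : HasPolyCoeffs D δ g) (p : ℕ)
    (h : ∀ x k, f (x, k) - f (x - p, k - 1) = g (x, k)) : HasPolyCoeffs D (δ + 1) f := by
  obtain ⟨c, hc, hc'⟩ := hg
  let E : ℕ → ℕ → ℤ := fun k => Nat.rec 0 (fun k e => c k + shiftCoeffs^[p] e) k
  have hE : ∀ k, E (k + 1) = c k + shiftCoeffs^[p] (E k) := fun k => rfl
  -- The offset by one makes `e` vanish at all negative `k`, including `-1`, so the recursion also
  -- holds at `k = 0`.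
  let e : ℤ → ℕ → ℤ := fun k => E (k + 1).toNat
  have he : ∀ k : ℕ, e k = c k + shiftCoeffs^[p] (e (k - 1)) := by
    intro k
    simp only [e, sub_add_cancel]
    rw [show ((k : ℤ) + 1).toNat = k + 1 by omega, hE, Int.toNat_natCast]
  have hcoe : ∀ k : ℤ, IterCoeffs (fun x => f (x, k)) D (e k) := by
    have hneg : ∀ k < 0, IterCoeffs (fun x => f (x, k)) D (e k) := by
      intro k hk
      have h1 : e k = 0 := by
        simp only [e]; rw [show (k + 1).toNat = 0 by omega]; rfl
      have h2 : (fun x => f (x, k)) = 0 := funext (hb k hk)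
      rw [h1, h2]
      exact IterCoeffs.zero D
    have hstep : ∀ k : ℕ, IterCoeffs (fun x => f (x, (k : ℤ) - 1)) D (e ((k : ℤ) - 1)) →
        IterCoeffs (fun x => f (x, (k : ℤ))) D (e k) := by
      intro k hk
      rw [he]
      convert (hc k).add (hk.translate p) using 1
      funext x
      have := h x k
      simp only [Pi.add_apply]
      linarith
    intro k
    rcases lt_or_ge k 0 with hk | hk
    · exact hneg k hk
    · lift k to ℕ using hk
      induction k with
      | zero => exact hstep 0 (hneg _ (by norm_num))
      | succ k ih => exact hstep (k + 1) (by simpa using ih)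
  refine ⟨e, hcoe, fun j => ?_⟩
  induction j using Nat.strong_induction_on with
  | _ j ih =>
    -- Repeated shifting changes the `j`-th entry only by entries with index `j' < j`. Their bound
    -- `δ + 1 + j'` is at most `δ + j`.
    have key : ∀ a : ℕ,
        EventuallyPoly (δ + j) (fun k => shiftCoeffs^[a] (e k) j - e k j) ∧
        ∀ j' < j, EventuallyPoly (δ + j) (fun k => shiftCoeffs^[a] (e k) j') := by
      intro a
      induction a with
      | zero =>
        refine ⟨?_, fun j' hj' => (ih j' hj').mono (by omega)⟩
        simp only [Function.iterate_zero, id, sub_self]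
        exact EventuallyPoly.zero (δ + j)
      | succ a iha =>
        simp only [Function.iterate_succ_apply']
        refine ⟨?_, fun j' hj' => ?_⟩
        · rcases j with _ | j
          · exact iha.1
          · convert iha.1.add (iha.2 j (by omega)) using 1
            funext k
            simp only [shiftCoeffs, Pi.add_apply]
            ring
        · rcases j' with _ | j'
          · exact iha.2 0 hj'
          · exact (iha.2 (j' + 1) hj').add (iha.2 j' (by omega))
    rw [add_right_comm]
    apply EventuallyPoly.of_diff
    refine ((hc' j).add ((key p).1.translate 1)).congr ?_
    filter_upwards [eventually_ge_atTop 0] with k hk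
    lift k to ℕ using hk
    have := congrFun (he k) j
    simp only [Pi.add_apply] at this ⊢
    linarith

end HasPolyCoeffs

/-! ### Graded vector spaces, homogeneous submodules and dimension counts. -/

theorem finrank_map_add_finrank_inf_ker {K V W : Type*} [Field K] [AddCommGroup V] [Module K V]
    [AddCommGroup W] [Module K W] (f : V →ₗ[K] W) (U : Submodule K V) [FiniteDimensional K U] :
    Module.finrank K (U.map f) + Module.finrank K (U ⊓ LinearMap.ker f : Submodule K V) =
      Module.finrank K U := by
  have h := LinearMap.finrank_range_add_finrank_ker (f.domRestrict U)
  rw [LinearMap.range_domRestrict] at h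
  rw [← h, LinearMap.ker_domRestrict, ← Submodule.map_comap_subtype,
    Submodule.finrank_map_subtype_eq]

/-- The ideal of all `a` with `a • z ∈ Q`. -/
def colonIdeal {R V : Type*} [CommRing R] [AddCommGroup V] [Module R V] (Q : Submodule R V)
    (z : V) : Ideal R :=
  Q.comap (LinearMap.toSpanSingleton R V z)

theorem mem_colonIdeal {R V : Type*} [CommRing R] [AddCommGroup V] [Module R V]
    {Q : Submodule R V} {z : V} {a : R} : a ∈ colonIdeal Q z ↔ a • z ∈ Q := Iff.rfl

/-- A family of projections onto the submodules `𝒱 c`, which exhibits `V` as their direct sum. -/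
structure GradedProj {K V ι : Type*} [Field K] [AddCommGroup V] [Module K V]
    (𝒱 : ι → Submodule K V) where
  π : ι → V →ₗ[K] V
  mem : ∀ c v, π c v ∈ 𝒱 c
  same : ∀ c, ∀ v ∈ 𝒱 c, π c v = v
  ne : ∀ c e, ∀ v ∈ 𝒱 c, c ≠ e → π e v = 0
  iSup_eq_top : ⨆ c, 𝒱 c = ⊤

namespace GradedProj

section Basic

variable {K V ι : Type*} [Field K] [AddCommGroup V] [Module K V] {𝒱 : ι → Submodule K V}
  (G : GradedProj 𝒱)

include G in
theorem induction {P : V → Prop} (h0 : P 0) (hadd : ∀ u v, P u → P v → P (u + v))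
    (hmem : ∀ c, ∀ v ∈ 𝒱 c, P v) (v : V) : P v := by
  have hv : v ∈ ⨆ c, 𝒱 c := by rw [G.iSup_eq_top]; trivial
  exact Submodule.iSup_induction 𝒱 (motive := P) hv hmem h0 hadd

/-- The quantification over all larger index sets allows the sums for two elements to be taken over
a common set. -/
theorem exists_sum (v : V) : ∃ s : Finset ι, ∀ t, s ⊆ t → ∑ c ∈ t, G.π c v = v := by
  classical
  induction v using G.induction with
  | h0 => exact ⟨∅, fun t _ => by simp⟩
  | hadd u v hu hv =>
    obtain ⟨s, hs⟩ := hu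
    obtain ⟨s', hs'⟩ := hv
    refine ⟨s ∪ s', fun t ht => ?_⟩
    simp only [map_add, Finset.sum_add_distrib]
    rw [hs t (Finset.union_subset_left ht), hs' t (Finset.union_subset_right ht)]
  | hmem c v hv =>
    refine ⟨{c}, fun t ht => ?_⟩
    rw [Finset.sum_eq_single c (fun e _ he => G.ne c e v hv he.symm)
      (fun h => absurd (Finset.singleton_subset_iff.1 ht) h), G.same c v hv]

theorem exists_sum_eq (v : V) : ∃ s : Finset ι, ∑ c ∈ s, G.π c v = v :=
  (G.exists_sum v).imp fun s hs => hs s subset_rfl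

/-- A projection as in `GradedProj` from a `DirectSum.Decomposition`. -/
noncomputable def ofDecomposition [DecidableEq ι] (𝒱 : ι → Submodule K V)
    [DirectSum.Decomposition 𝒱] : GradedProj 𝒱 where
  π c := (𝒱 c).subtype ∘ₗ DirectSum.component K ι (fun c => 𝒱 c) c ∘ₗ
    (DirectSum.decomposeLinearEquiv 𝒱).toLinearMap
  mem _ _ := Subtype.prop _
  same _ _ hv := DirectSum.decompose_of_mem_same 𝒱 hv
  ne _ _ _ hv h := DirectSum.decompose_of_mem_ne 𝒱 hv h
  iSup_eq_top := (DirectSum.Decomposition.isInternal 𝒱).submodule_iSup_eq_top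

/-- Transport of a grading to a space of functions with shifts, along an equivalence. -/
noncomputable def pi [AddCommGroup ι] {β W : Type*} [Finite β] [AddCommGroup W] [Module K W]
    (a : β → ι) (E : W ≃ₗ[K] (β → V)) (𝒲 : ι → Submodule K W)
    (h : ∀ c w, w ∈ 𝒲 c ↔ ∀ b, E w b ∈ 𝒱 (c + a b)) : GradedProj 𝒲 where
  π c := E.symm.toLinearMap ∘ₗ (LinearMap.pi fun b => G.π (c + a b) ∘ₗ LinearMap.proj b) ∘ₗ
    E.toLinearMap
  mem c v := by
    rw [h]
    intro b
    simpa using G.mem _ _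
  same c v hv := by
    rw [h] at hv
    simp only [LinearMap.comp_apply, LinearEquiv.coe_coe]
    rw [LinearEquiv.symm_apply_eq]
    funext b
    exact G.same _ _ (hv b)
  ne c e v hv hce := by
    rw [h] at hv
    simp only [LinearMap.comp_apply, LinearEquiv.coe_coe]
    rw [LinearEquiv.symm_apply_eq, map_zero]
    funext b
    exact G.ne _ _ _ (hv b) (fun h => hce (add_right_cancel h))
  iSup_eq_top := by
    classical
    rw [eq_top_iff]
    intro w _
    have := Fintype.ofFinite β
    have hw : w = ∑ b, E.symm (Pi.single b (E w b)) := by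
      rw [← map_sum, Finset.univ_sum_single, LinearEquiv.symm_apply_apply]
    rw [hw]
    refine Submodule.sum_mem _ fun b _ => ?_
    generalize E w b = v
    induction v using G.induction with
    | h0 => simp
    | hadd u v hu hv => rw [Pi.single_add, map_add]; exact Submodule.add_mem _ hu hv
    | hmem c v hv =>
      refine Submodule.mem_iSup_of_mem (c - a b) ?_
      rw [h]
      intro b'
      rw [LinearEquiv.apply_symm_apply]
      rcases eq_or_ne b' b with rfl | hb
      · rwa [Pi.single_eq_same, sub_add_cancel]
      · rw [Pi.single_eq_of_ne hb]; exact Submodule.zero_mem _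

end Basic

section Module

variable {K R V V' ι : Type*} [Field K] [CommRing R] [AddCommGroup V] [Module K V]
  [Module R V] [AddCommGroup V'] [Module K V'] [Module R V']
  {𝒱 : ι → Submodule K V} {𝒱' : ι → Submodule K V'}
  (G : GradedProj 𝒱) (G' : GradedProj 𝒱')

/-- A submodule which contains the homogeneous components of its elements. -/
def IsHomog (Q : Submodule R V) : Prop := ∀ v ∈ Q, ∀ c, G.π c v ∈ Q

theorem map_π {F : Type*} [FunLike F V V'] [AddMonoidHomClass F V V'] (f : F)
    (hf : ∀ c, ∀ v ∈ 𝒱 c, f v ∈ 𝒱' c) (c : ι) (v : V) : G'.π c (f v) = f (G.π c v) := by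
  induction v using G.induction with
  | h0 => simp
  | hadd u v hu hv => simp [hu, hv]
  | hmem e v hv =>
    rcases eq_or_ne e c with rfl | h
    · rw [G'.same _ _ (hf _ _ hv), G.same _ _ hv]
    · rw [G'.ne _ _ _ (hf _ _ hv) h, G.ne _ _ _ hv h, map_zero]

include G' in
theorem isHomog_ker (f : V →ₗ[R] V') (hf : ∀ c, ∀ v ∈ 𝒱 c, f v ∈ 𝒱' c) :
    G.IsHomog (LinearMap.ker f) := by
  intro v hv c
  rw [LinearMap.mem_ker] at hv ⊢
  rw [← G.map_π G' f hf, hv, map_zero]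

include G in
theorem isHomog_range (f : V →ₗ[R] V') (hf : ∀ c, ∀ v ∈ 𝒱 c, f v ∈ 𝒱' c) :
    G'.IsHomog (LinearMap.range f) := by
  rintro _ ⟨v, rfl⟩ c
  exact ⟨G.π c v, (G.map_π G' f hf c v).symm⟩

theorem isHomog_top : G.IsHomog (⊤ : Submodule R V) := fun _ _ _ => trivial

theorem IsHomog.eq_span {G : GradedProj 𝒱} {Q : Submodule R V} (hQ : G.IsHomog Q) :
    Q = Submodule.span R {v | v ∈ Q ∧ ∃ c, v ∈ 𝒱 c} := by
  refine le_antisymm (fun v hv => ?_) (Submodule.span_le.2 fun v hv => hv.1)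
  obtain ⟨s, hs⟩ := G.exists_sum_eq v
  rw [← hs]
  exact Submodule.sum_mem _ fun c _ => Submodule.subset_span ⟨hQ v hv c, c, G.mem c v⟩

theorem IsHomog.le_of_forall {G : GradedProj 𝒱} {Q Q' : Submodule R V} (hQ : G.IsHomog Q)
    (h : ∀ c, ∀ v ∈ 𝒱 c, v ∈ Q → v ∈ Q') : Q ≤ Q' := by
  rw [hQ.eq_span, Submodule.span_le]
  rintro v ⟨hv, c, hc⟩
  exact h c v hc hv

theorem IsHomog.exists_finset {G : GradedProj 𝒱} {Q : Submodule R V} (hQ : G.IsHomog Q)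
    (hfg : Q.FG) :
    ∃ s : Finset V, (∀ z ∈ s, z ∈ Q ∧ ∃ c, z ∈ 𝒱 c) ∧ Submodule.span R (s : Set V) = Q := by
  have hfg' := hfg
  rw [hQ.eq_span, Submodule.fg_span_iff_fg_span_finset_subset] at hfg'
  obtain ⟨t, ht, hspan⟩ := hfg'
  exact ⟨t, fun z hz => ht hz, by rw [← hspan, ← hQ.eq_span]⟩

variable [Algebra K R] [AddCommGroup ι] {𝒜 : ι → Submodule K R} (GA : GradedProj 𝒜)
  (hsmul : ∀ c e, ∀ a ∈ 𝒜 c, ∀ v ∈ 𝒱 e, a • v ∈ 𝒱 (c + e))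

include hsmul in
theorem π_smul {e : ι} {z : V} (hz : z ∈ 𝒱 e) (c : ι) (a : R) :
    G.π c (a • z) = GA.π (c - e) a • z := by
  induction a using GA.induction with
  | h0 => simp
  | hadd u v hu hv => simp [add_smul, hu, hv]
  | hmem d a ha =>
    rcases eq_or_ne d (c - e) with rfl | h
    · have := hsmul _ _ _ ha _ hz
      rw [sub_add_cancel] at this
      rw [G.same _ _ this, GA.same _ _ ha]
    · rw [G.ne _ _ _ (hsmul _ _ _ ha _ hz) (fun h' => h (eq_sub_of_add_eq h')),
        GA.ne _ _ _ ha h, zero_smul]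

include hsmul in
theorem IsHomog.sup_span_singleton {G : GradedProj 𝒱} {Q : Submodule R V} (hQ : G.IsHomog Q)
    {e : ι} {z : V} (hz : z ∈ 𝒱 e) (GA : GradedProj 𝒜) :
    G.IsHomog (Q ⊔ Submodule.span R {z}) := by
  intro v hv c
  obtain ⟨q, hq, u, hu, rfl⟩ := Submodule.mem_sup.1 hv
  obtain ⟨a, rfl⟩ := Submodule.mem_span_singleton.1 hu
  rw [map_add, G.π_smul GA hsmul hz]
  exact Submodule.add_mem_sup (hQ q hq c)
    (Submodule.smul_mem _ _ (Submodule.mem_span_singleton_self z))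

include hsmul in
theorem IsHomog.colonIdeal {G : GradedProj 𝒱} {Q : Submodule R V} (hQ : G.IsHomog Q)
    {e : ι} {z : V} (hz : z ∈ 𝒱 e) : GA.IsHomog (colonIdeal Q z) := by
  intro a ha c
  have := hQ _ ha (c + e)
  rw [LinearMap.toSpanSingleton_apply, G.π_smul GA hsmul hz, add_sub_cancel_right] at this
  exact this

include GA hsmul in
-- Multiplication by `z` gives `R/(Q : z)(-e) ≅ (Q + Rz)/Q`. This compares dimensions in degree `c`,
-- stated additively to avoid subtraction in `ℕ`.
theorem finrank_sup_span_singleton [IsScalarTower K R V] [∀ c, FiniteDimensional K (𝒱 c)]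
    [∀ c, FiniteDimensional K (𝒜 c)] {Q : Submodule R V}
    (hQ : G.IsHomog Q) {e : ι} {z : V} (hz : z ∈ 𝒱 e) (c : ι) :
    Module.finrank K (𝒱 c ⊓ (Q ⊔ Submodule.span R {z}).restrictScalars K : Submodule K V) +
        Module.finrank K
          (𝒜 (c - e) ⊓ (_root_.colonIdeal Q z).restrictScalars K : Submodule K R) =
      Module.finrank K (𝒱 c ⊓ Q.restrictScalars K : Submodule K V) +
        Module.finrank K (𝒜 (c - e)) := by
  set W₀ := (𝒱 c ⊓ Q.restrictScalars K : Submodule K V) with hW₀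
  set W₁ := (𝒱 c ⊓ (Q ⊔ Submodule.span R {z}).restrictScalars K : Submodule K V) with hW₁
  have hle : W₀ ≤ W₁ := fun v hv => ⟨hv.1, Submodule.mem_sup_left hv.2⟩
  have : FiniteDimensional K W₁ := Submodule.finiteDimensional_of_le inf_le_left
  let φ : R →ₗ[K] V ⧸ W₀ := W₀.mkQ ∘ₗ (LinearMap.toSpanSingleton R V z).restrictScalars K
  have hφ : ∀ a, φ a = W₀.mkQ (a • z) := fun a => rfl
  have h1 := finrank_map_add_finrank_inf_ker φ (𝒜 (c - e))
  have h2 := finrank_map_add_finrank_inf_ker W₀.mkQ W₁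
  rw [Submodule.ker_mkQ, inf_eq_right.2 hle] at h2
  have h3 : (𝒜 (c - e)).map φ = W₁.map W₀.mkQ := by
    ext y
    constructor
    · rintro ⟨a, ha, rfl⟩
      refine ⟨a • z, ⟨?_, ?_⟩, rfl⟩
      · simpa using hsmul _ _ _ ha _ hz
      · exact Submodule.mem_sup_right
          (Submodule.smul_mem _ _ (Submodule.mem_span_singleton_self z))
    · rintro ⟨v, ⟨hvc, hv⟩, rfl⟩
      obtain ⟨q, hq, u, hu, rfl⟩ := Submodule.mem_sup.1 hv
      obtain ⟨a, rfl⟩ := Submodule.mem_span_singleton.1 hu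
      -- The degree `c` part of `q + a • z` is itself. It equals a homogeneous element of `Q` plus
      -- the degree `c - e` part of `a` times `z`.
      refine ⟨GA.π (c - e) a, GA.mem _ _, ?_⟩
      have h := G.same c _ hvc
      rw [map_add, G.π_smul GA hsmul hz] at h
      rw [hφ, ← h, map_add, right_eq_add, Submodule.mkQ_apply, Submodule.Quotient.mk_eq_zero]
      exact ⟨G.mem c q, hQ q hq c⟩
  have h4 : (𝒜 (c - e) ⊓ LinearMap.ker φ : Submodule K R) =
      (𝒜 (c - e) ⊓ (_root_.colonIdeal Q z).restrictScalars K : Submodule K R) := by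
    ext a
    simp only [Submodule.mem_inf, LinearMap.mem_ker, hφ, Submodule.mkQ_apply,
      Submodule.Quotient.mk_eq_zero, Submodule.restrictScalars_mem, hW₀, mem_colonIdeal]
    refine and_congr_right fun ha => and_iff_right ?_
    simpa using hsmul _ _ _ ha _ hz
  rw [h3, h4] at h1
  omega

end Module

end GradedProj

/-! ### Krull dimension modulo a regular element. -/

section Dimension

theorem ringKrullDim_quotient_mono {R : Type*} [CommRing R] {I J : Ideal R} (h : I ≤ J) :
    ringKrullDim (R ⧸ J) ≤ ringKrullDim (R ⧸ I) :=
  ringKrullDim_le_of_surjective _ (Ideal.Quotient.factor_surjective h)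

theorem ringKrullDim_quotient_sup_span_add_one_le {R : Type*} [CommRing R] {I : Ideal R} {r : R}
    (hr : ∀ a, a * r ∈ I → a ∈ I) :
    ringKrullDim (R ⧸ (I ⊔ Ideal.span {r})) + 1 ≤ ringKrullDim (R ⧸ I) := by
  have h : Ideal.Quotient.mk I r ∈ nonZeroDivisors (R ⧸ I) := by
    rw [mem_nonZeroDivisors_iff_right]
    intro x hx
    obtain ⟨a, rfl⟩ := Ideal.Quotient.mk_surjective x
    rw [← map_mul, Ideal.Quotient.eq_zero_iff_mem] at hx
    exact Ideal.Quotient.eq_zero_iff_mem.2 (hr a hx)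
  have h2 := ringKrullDim_quotient_succ_le_of_nonZeroDivisor h
  rwa [← Set.image_singleton, ← Ideal.map_span,
    ringKrullDim_eq_of_ringEquiv (DoubleQuot.quotQuotEquivQuotSup I (Ideal.span {r}))] at h2

/-- For a proper ideal the dimension is at least `0` rather than `⊥`, which forces `D` to be
positive. -/
theorem exists_eq_succ_of_ringKrullDim_add_one_le {R : Type*} [CommRing R] {I : Ideal R}
    (hI : I ≠ ⊤) {D : ℕ} (h : ringKrullDim (R ⧸ I) + 1 ≤ (D : WithBot ℕ∞)) :
    ∃ D' : ℕ, D = D' + 1 ∧ ringKrullDim (R ⧸ I) ≤ (D' : WithBot ℕ∞) := by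
  have : Nontrivial (R ⧸ I) := Ideal.Quotient.nontrivial_iff.2 hI
  have h0 : 0 ≤ ringKrullDim (R ⧸ I) := ringKrullDim_nonneg_of_nontrivial
  generalize ringKrullDim (R ⧸ I) = d at *
  rcases D with _ | D
  · exfalso
    have : (1 : WithBot ℕ∞) ≤ 0 := by
      calc (1 : WithBot ℕ∞) = 0 + 1 := by simp
        _ ≤ d + 1 := by gcongr
        _ ≤ 0 := by simpa using h
    exact absurd this (by norm_num)
  · refine ⟨D, rfl, ?_⟩
    lift d to ℕ∞ using (fun h => by simp [h] at h0)
    norm_cast at h ⊢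
    exact (ENat.add_le_add_iff_right (k := 1) ENat.one_ne_top).1 (by exact_mod_cast h)

end Dimension

/-! ### The bigraded ring `A` and the Hilbert functions of its cyclic modules. -/

section Ring

variable {K : Type*} [Field K] {n m : ℕ} (p : Fin m → ℕ)

/-- The bidegrees of the variables of `A`. -/
abbrev wt (n : ℕ) {m : ℕ} (p : Fin m → ℕ) : Fin n ⊕ Fin m → ℤ × ℤ :=
  Sum.elim (fun _ => ((1 : ℤ), (0 : ℤ))) (fun j => ((p j : ℤ), (1 : ℤ)))

theorem mem_gradingA {c : ℤ × ℤ} {f : PolyA K n m} :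
    f ∈ gradingA K n p c ↔ IsWeightedHomogeneous (wt n p) f c := Iff.rfl

theorem weight_wt (d : Fin n ⊕ Fin m →₀ ℕ) : Finsupp.weight (wt n p) d =
    ((∑ i, (d (Sum.inl i) : ℤ)) + ∑ t, (d (Sum.inr t) : ℤ) * p t, ∑ t, (d (Sum.inr t) : ℤ)) := by
  rw [Finsupp.weight_apply, Finsupp.sum_fintype _ _ (by simp), Fintype.sum_sum_type]
  ext <;> simp [Prod.fst_sum, Prod.snd_sum]

theorem weight_wt_nonneg (d : Fin n ⊕ Fin m →₀ ℕ) :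
    0 ≤ (Finsupp.weight (wt n p) d).1 ∧ 0 ≤ (Finsupp.weight (wt n p) d).2 := by
  rw [weight_wt]
  constructor <;> positivity

theorem gradingA_eq_bot {c : ℤ × ℤ} (h : c.1 < 0 ∨ c.2 < 0) : gradingA K n p c = ⊥ := by
  rw [eq_bot_iff]
  intro f hf
  ext d
  by_contra hd
  have h1 := mem_gradingA p |>.1 hf hd
  have h2 := weight_wt_nonneg p d
  rw [h1] at h2
  omega

/-- The second degree counts the `y`-variables, so it bounds their exponents even when some `p t =
0`. The first degree bounds the exponents of the `x`-variables since the `p t` are nonnegative. -/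
theorem le_of_weight_wt {c : ℤ × ℤ} {d : Fin n ⊕ Fin m →₀ ℕ} (h : Finsupp.weight (wt n p) d = c)
    (s : Fin n ⊕ Fin m) : d s ≤ max c.1.toNat c.2.toNat := by
  rw [weight_wt] at h
  subst h
  rcases s with i | t
  · have h1 := Finset.single_le_sum (f := fun i => (d (Sum.inl i) : ℤ)) (fun _ _ => by positivity)
      (Finset.mem_univ i)
    have h2 : 0 ≤ ∑ t, (d (Sum.inr t) : ℤ) * p t := by positivity
    simp only at h1 ⊢
    omega
  · have h1 := Finset.single_le_sum (f := fun i => (d (Sum.inr i) : ℤ)) (fun _ _ => by positivity)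
      (Finset.mem_univ t)
    simp only at h1 ⊢
    omega

theorem eq_zero_of_weight_wt {d : Fin n ⊕ Fin m →₀ ℕ} (h : Finsupp.weight (wt n p) d = 0) :
    d = 0 := by
  ext s
  simpa using le_of_weight_wt p h s

instance finiteDimensional_gradingA (c : ℤ × ℤ) : FiniteDimensional K (gradingA K n p c) := by
  have hfin : {d : Fin n ⊕ Fin m →₀ ℕ | Finsupp.weight (wt n p) d = c}.Finite := by
    refine (Set.finite_Iic (Finsupp.equivFunOnFinite.symm
      fun _ => max c.1.toNat c.2.toNat : Fin n ⊕ Fin m →₀ ℕ)).subset fun d hd s => ?_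
    exact le_of_weight_wt p hd s
  have hle : gradingA K n p c ≤ Submodule.span K
      ((fun d => monomial d (1 : K)) '' {d | Finsupp.weight (wt n p) d = c}) := by
    intro f hf
    rw [← f.support_sum_monomial_coeff]
    refine Submodule.sum_mem _ fun d hd => ?_
    have : monomial d (coeff d f) = coeff d f • monomial d (1 : K) := by
      rw [smul_monomial, smul_eq_mul, mul_one]
    rw [this]
    exact Submodule.smul_mem _ _ (Submodule.subset_span
      ⟨d, hf (mem_support_iff.1 hd), rfl⟩)
  have := FiniteDimensional.span_of_finite K (hfin.image fun d => monomial d (1 : K))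
  exact Submodule.finiteDimensional_of_le hle

/-- The projections onto the homogeneous components of `A`. -/
noncomputable def projA (K : Type*) [Field K] (n : ℕ) {m : ℕ} (p : Fin m → ℕ) :
    GradedProj (gradingA K n p) where
  π c := weightedHomogeneousComponent (wt n p) c
  mem c f := weightedHomogeneousComponent_mem _ f c
  same c f hf := IsWeightedHomogeneous.weightedHomogeneousComponent_same hf
  ne c e f hf h := IsWeightedHomogeneous.weightedHomogeneousComponent_ne e hf h.symm
  iSup_eq_top := by
    rw [eq_top_iff]
    intro f _
    rw [← f.support_sum_monomial_coeff]
    exact Submodule.sum_mem _ fun d _ => Submodule.mem_iSup_of_mem _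
      (isWeightedHomogeneous_monomial (wt n p) d (coeff d f) rfl)

theorem gradingA_mul (c e : ℤ × ℤ) : ∀ a ∈ gradingA K n p c, ∀ b ∈ gradingA K n p e,
    a • b ∈ gradingA K n p (c + e) :=
  fun _ ha _ hb => IsWeightedHomogeneous.mul ha hb

theorem X_mem_gradingA (s : Fin n ⊕ Fin m) : (X s : PolyA K n m) ∈ gradingA K n p (wt n p s) :=
  isWeightedHomogeneous_X K _ s

/-- The irrelevant ideal `(x_1, …, x_n, y_1, …, y_m)` of `A`. -/
noncomputable def irrelevant (K : Type*) [Field K] (n m : ℕ) : Ideal (PolyA K n m) :=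
  RingHom.ker (constantCoeff (R := K) (σ := Fin n ⊕ Fin m))

theorem irrelevant_ne_top : irrelevant K n m ≠ ⊤ := RingHom.ker_ne_top _

theorem X_mem_irrelevant (s : Fin n ⊕ Fin m) : (X s : PolyA K n m) ∈ irrelevant K n m := by
  simp [irrelevant, RingHom.mem_ker]

theorem idealX_le_irrelevant : idealX K n m ≤ irrelevant K n m := by
  rw [idealX, Ideal.span_le]
  rintro _ ⟨i, rfl⟩
  exact X_mem_irrelevant _

theorem gradingA_le_irrelevant {c : ℤ × ℤ} (hc : c ≠ 0) {f : PolyA K n m}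
    (hf : f ∈ gradingA K n p c) : f ∈ irrelevant K n m := by
  rw [irrelevant, RingHom.mem_ker, constantCoeff_eq]
  by_contra h
  exact hc (by simpa using (hf h).symm)

/-- The degree zero part of `A` is `K`, so an element with nonzero constant term has a unit as its
degree zero component. -/
theorem GradedProj.IsHomog.le_irrelevant {I : Ideal (PolyA K n m)} (hI : (projA K n p).IsHomog I)
    (h : I ≠ ⊤) : I ≤ irrelevant K n m := by
  intro f hf
  by_contra hf'
  apply h
  have h1 := hI f hf 0
  have h2 : (projA K n p).π 0 f = C (coeff 0 f) := by
    change weightedHomogeneousComponent (wt n p) 0 f = _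
    classical
    ext d
    rw [coeff_weightedHomogeneousComponent, coeff_C]
    by_cases hd : d = 0
    · subst hd; simp
    · rw [if_neg (fun h => hd (eq_zero_of_weight_wt p h)), if_neg (Ne.symm hd)]
  rw [h2] at h1
  refine Ideal.eq_top_of_isUnit_mem _ h1 (IsUnit.map C ?_)
  rw [irrelevant, RingHom.mem_ker, constantCoeff_eq] at hf'
  exact isUnit_iff_ne_zero.2 hf'

theorem irrelevant_le {I : Ideal (PolyA K n m)} (h : ∀ s, (X s : PolyA K n m) ∈ I) :
    irrelevant K n m ≤ I := by
  intro f hf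
  rw [← f.support_sum_monomial_coeff]
  refine Ideal.sum_mem _ fun d hd => ?_
  have hd0 : d ≠ 0 := by
    rintro rfl
    rw [irrelevant, RingHom.mem_ker, constantCoeff_eq] at hf
    exact mem_support_iff.1 hd hf
  obtain ⟨s, hs⟩ := Finsupp.ne_iff.1 hd0
  have : (X s : PolyA K n m) ∣ monomial d (coeff d f) := by
    rw [X_dvd_monomial]
    exact Or.inr (by simpa using hs)
  exact Ideal.mem_of_dvd _ this (h s)

theorem algebraMap_X (i : Fin n) :
    algebraMap (PolyS K n) (PolyA K n m) (X i) = X (Sum.inl i) := rename_X _ _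

/-- The bigraded Hilbert function of `A / I`. -/
noncomputable def hilbQuot (I : Ideal (PolyA K n m)) (c : ℤ × ℤ) : ℤ :=
  Module.finrank K (gradingA K n p c) -
    Module.finrank K (gradingA K n p c ⊓ I.restrictScalars K : Submodule K (PolyA K n m))

theorem hilbQuot_eq_zero {I : Ideal (PolyA K n m)} {c : ℤ × ℤ}
    (h : ∀ f ∈ gradingA K n p c, f ∈ I) : hilbQuot p I c = 0 := by
  rw [hilbQuot, inf_eq_left.2 h, sub_self]

theorem hilbQuot_eq_zero_of_neg (I : Ideal (PolyA K n m)) {c : ℤ × ℤ} (h : c.1 < 0 ∨ c.2 < 0) :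
    hilbQuot p I c = 0 := by
  refine hilbQuot_eq_zero p fun f hf => ?_
  rw [gradingA_eq_bot p h, Submodule.mem_bot] at hf
  rw [hf]; exact I.zero_mem

theorem hilbQuot_eq_add {I : Ideal (PolyA K n m)} (hI : (projA K n p).IsHomog I) {e : ℤ × ℤ}
    {z : PolyA K n m} (hz : z ∈ gradingA K n p e) (c : ℤ × ℤ) :
    hilbQuot p I c = hilbQuot p (I ⊔ Ideal.span {z}) c + hilbQuot p (colonIdeal I z) (c - e) := by
  have := (projA K n p).finrank_sup_span_singleton (projA K n p) (gradingA_mul p) hI hz c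
  simp only [hilbQuot, Ideal.span] at this ⊢
  omega

/-- Stating this for all upper bounds `D` and `δ`, not only for the exact dimensions, lets both
outer terms of the exact sequence be used with the same parameters. -/
theorem hasPolyCoeffs_hilbQuot (I : Ideal (PolyA K n m)) (hI : (projA K n p).IsHomog I) (D δ : ℕ)
    (hD : ringKrullDim (PolyS K n ⧸ I.comap (algebraMap (PolyS K n) (PolyA K n m))) ≤ D)
    (hδ : ringKrullDim (PolyA K n m ⧸ (I ⊔ idealX K n m)) ≤ δ) :
    HasPolyCoeffs D δ (hilbQuot p I) := by
  induction I using WellFoundedGT.induction generalizing D δ with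
  | _ I ih =>
    by_cases htop : I = ⊤
    · convert HasPolyCoeffs.zero D δ
      funext c
      exact hilbQuot_eq_zero p fun f _ => by rw [htop]; trivial
    have hsup : ∀ s, (projA K n p).IsHomog (I ⊔ Ideal.span {(X s : PolyA K n m)}) := fun s =>
      hI.sup_span_singleton (gradingA_mul p) (X_mem_gradingA p s) (projA K n p)
    have hlt : ∀ s, (X s : PolyA K n m) ∉ I → I < I ⊔ Ideal.span {(X s : PolyA K n m)} :=
      fun s hs => left_lt_sup.2 fun h => hs (h (Ideal.mem_span_singleton_self _))
    have hle : ∀ s, I ≤ colonIdeal I (X s : PolyA K n m) := fun s a ha => by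
      rw [mem_colonIdeal, smul_eq_mul]
      exact I.mul_mem_right _ ha
    have hne : ∀ s, I ⊔ Ideal.span {(X s : PolyA K n m)} ≠ ⊤ := fun s h =>
      irrelevant_ne_top (K := K) (n := n) (m := m) (top_le_iff.1 (h ▸ sup_le
        (hI.le_irrelevant p htop)
        ((Ideal.span_singleton_le_iff_mem _).2 (X_mem_irrelevant s))))
    -- the case of a variable which is a zero divisor modulo `I`
    have hzd : ∀ s, (X s : PolyA K n m) ∉ I → colonIdeal I (X s : PolyA K n m) ≠ I →
        HasPolyCoeffs D δ (hilbQuot p I) := by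
      intro s hs hc
      have key : ∀ J : Ideal (PolyA K n m), I < J → (projA K n p).IsHomog J →
          HasPolyCoeffs D δ (hilbQuot p J) := fun J hJ hJh => ih J hJ hJh D δ
        ((ringKrullDim_quotient_mono (Ideal.comap_mono hJ.le)).trans hD)
        ((ringKrullDim_quotient_mono (sup_le_sup_right hJ.le _)).trans hδ)
      have h1 := key _ (hlt s hs) (hsup s)
      have h2 := (key _ (lt_of_le_of_ne (hle s) (Ne.symm hc))
        (hI.colonIdeal (projA K n p) (gradingA_mul p) (X_mem_gradingA p s))).translate (wt n p s)
      convert h1.add h2 using 1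
      funext c
      exact hilbQuot_eq_add p hI (X_mem_gradingA p s) c
    by_cases hx : ∃ i : Fin n, (X (Sum.inl i) : PolyA K n m) ∉ I
    · obtain ⟨i, hi⟩ := hx
      by_cases hc : colonIdeal I (X (Sum.inl i) : PolyA K n m) = I
      swap
      · exact hzd _ hi hc
      -- Since `x_i` is regular modulo `I`, it is regular modulo `I ∩ S`. Moreover `(I + x_i) ∩ S`
      -- contains `(I ∩ S) + x_i`, so its quotient has dimension at most `D - 1`.
      have hdim : ringKrullDim (PolyS K n ⧸ (I ⊔ Ideal.span {(X (Sum.inl i) : PolyA K n m)}).comap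
          (algebraMap (PolyS K n) (PolyA K n m))) + 1 ≤ (D : WithBot ℕ∞) := by
        refine le_trans ?_ ((ringKrullDim_quotient_sup_span_add_one_le
          (I := I.comap (algebraMap (PolyS K n) (PolyA K n m))) (r := X i) fun a ha => ?_).trans hD)
        · gcongr
          refine ringKrullDim_quotient_mono (sup_le (Ideal.comap_mono le_sup_left) ?_)
          rw [Ideal.span_singleton_le_iff_mem, Ideal.mem_comap, algebraMap_X]
          exact Ideal.mem_sup_right (Ideal.mem_span_singleton_self _)
        · rw [Ideal.mem_comap, map_mul, algebraMap_X] at ha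
          rw [Ideal.mem_comap, ← hc]
          exact ha
      obtain ⟨D', rfl, hD'⟩ := exists_eq_succ_of_ringKrullDim_add_one_le
        (fun h => hne (Sum.inl i) (by
          rw [Ideal.eq_top_iff_one] at h ⊢
          simpa using h)) hdim
      refine (ih _ (hlt _ hi) (hsup _) D' δ hD'
        ((ringKrullDim_quotient_mono (sup_le_sup_right le_sup_left _)).trans hδ)).of_diff_fst
        (fun k => ⟨0, fun x hx => hilbQuot_eq_zero_of_neg p I (Or.inl hx)⟩) fun x k => ?_
      have := hilbQuot_eq_add p hI (X_mem_gradingA p (Sum.inl i)) (x, k)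
      rw [hc] at this
      simp only [wt, Sum.elim_inl, Prod.mk_sub_mk, sub_zero] at this
      linarith
    push Not at hx
    -- All `x_i` now lie in `I`, so `δ` bounds `dim A/I` itself and drops modulo a regular `y_t`.
    have hIX : I ⊔ idealX K n m = I := by
      rw [sup_eq_left, idealX, Ideal.span_le]
      rintro _ ⟨i, rfl⟩
      exact hx i
    by_cases hy : ∃ t : Fin m, (X (Sum.inr t) : PolyA K n m) ∉ I
    · obtain ⟨t, ht⟩ := hy
      by_cases hc : colonIdeal I (X (Sum.inr t) : PolyA K n m) = I
      swap
      · exact hzd _ ht hc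
      have hdim : ringKrullDim (PolyA K n m ⧸ (I ⊔ Ideal.span {(X (Sum.inr t) : PolyA K n m)})) + 1
          ≤ (δ : WithBot ℕ∞) := by
        rw [hIX] at hδ
        refine (ringKrullDim_quotient_sup_span_add_one_le fun a ha => ?_).trans hδ
        rw [← hc]
        exact ha
      obtain ⟨δ', rfl, hδ'⟩ := exists_eq_succ_of_ringKrullDim_add_one_le (hne _) hdim
      refine (ih _ (hlt _ ht) (hsup _) D δ'
        ((ringKrullDim_quotient_mono (Ideal.comap_mono le_sup_left)).trans hD)
        ((ringKrullDim_quotient_mono le_sup_left).trans hδ')).of_diff_snd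
        (fun k hk x => hilbQuot_eq_zero_of_neg p I (Or.inr hk)) (p t) fun x k => ?_
      have := hilbQuot_eq_add p hI (X_mem_gradingA p (Sum.inr t)) (x, k)
      rw [hc] at this
      simp only [wt, Sum.elim_inr, Prod.mk_sub_mk] at this
      linarith
    push Not at hy
    have hirr : ∀ c ≠ 0, hilbQuot p I c = 0 := fun c hc => hilbQuot_eq_zero p fun f hf =>
      irrelevant_le (fun s => by rcases s with i | t; exacts [hx i, hy t])
        (gradingA_le_irrelevant p hc hf)
    -- At `k = 0` the function has finite support, so its own expansion is zero, but its iterated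
    -- sums need not be. This single slice does not affect the behaviour for large `k`.
    obtain ⟨c, hc⟩ := exists_iterCoeffs (f := fun x => hilbQuot p I (x, 0)) (b := 0) (D := D)
      (c₀ := 0) (fun x hx => hilbQuot_eq_zero_of_neg p I (Or.inl hx)) (by
        filter_upwards [eventually_gt_atTop 0] with x hx
        rw [binomExpansion_zero]
        refine hirr _ fun h => ?_
        simp only [Prod.mk_eq_zero] at h
        omega)
    refine ⟨fun k => if k = 0 then c else 0, fun k => ?_, fun j => ?_⟩
    · by_cases hk : k = 0
      · simpa [hk] using hc
      · simp only [if_neg hk]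
        convert IterCoeffs.zero D
        exact hirr _ (by simp [hk])
    · refine (EventuallyPoly.zero _).congr ?_
      filter_upwards [eventually_gt_atTop 0] with k hk
      simp [hk.ne']

end Ring

/-! ### Hilbert functions as iterated sums, and the dimensions that occur. -/

theorem iterHilbert_eq_sumOp {K T : Type*} [Field K] [AddCommGroup T] [Module K T]
    (𝒯 : ℤ → Submodule K T) (i : ℕ) (x : ℤ) :
    (iterHilbert 𝒯 i x : ℤ) = sumOp^[i] (fun x => (Module.finrank K (𝒯 x) : ℤ)) x := by
  induction i generalizing x with
  | zero => rfl
  | succ i ih =>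
    rw [Function.iterate_succ_apply', iterHilbert, sumOp]
    have h := (Nat.castAddMonoidHom ℤ).map_finsum_of_injective Nat.cast_injective
      (fun t : Set.Iic x => iterHilbert 𝒯 i t)
    simp only [Nat.coe_castAddMonoidHom] at h
    rw [h]
    exact finsum_congr fun t => ih t

theorem exists_ringKrullDim_quotient_eq {K σ : Type*} [Field K] [Finite σ]
    {I : Ideal (MvPolynomial σ K)} (hI : I ≠ ⊤) :
    ∃ D : ℕ, ringKrullDim (MvPolynomial σ K ⧸ I) = (D : WithBot ℕ∞) := by
  have : Nontrivial (MvPolynomial σ K ⧸ I) := Ideal.Quotient.nontrivial_iff.2 hI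
  have h0 : 0 ≤ ringKrullDim (MvPolynomial σ K ⧸ I) := ringKrullDim_nonneg_of_nontrivial
  have h1 := ringKrullDim_quotient_le I
  rw [MvPolynomial.ringKrullDim_of_isNoetherianRing, ringKrullDim_eq_zero_of_field, zero_add] at h1
  generalize ringKrullDim (MvPolynomial σ K ⧸ I) = d at *
  lift d to ℕ∞ using (fun h => by simp [h] at h0)
  have h2 : d ≤ (Nat.card σ : ℕ∞) := by exact_mod_cast h1
  lift d to ℕ using (fun h => by simp [h] at h2)
  exact ⟨d, rfl⟩

theorem ringKrullDim_quotient_idealX_le (K : Type*) [Field K] (n m : ℕ) :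
    ringKrullDim (PolyA K n m ⧸ idealX K n m) ≤ (m : WithBot ℕ∞) := by
  have hsurj : Function.Surjective ((Ideal.Quotient.mk (idealX K n m)).comp
      (rename (R := K) (Sum.inr : Fin m → Fin n ⊕ Fin m)).toRingHom) := by
    intro y
    obtain ⟨f, rfl⟩ := Ideal.Quotient.mk_surjective y
    induction f using MvPolynomial.induction_on with
    | C a => exact ⟨C a, by simp⟩
    | add f g hf hg =>
      obtain ⟨f', hf⟩ := hf
      obtain ⟨g', hg⟩ := hg
      exact ⟨f' + g', by rw [map_add, hf, hg, map_add]⟩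
    | mul_X f s hf =>
      obtain ⟨f', hf⟩ := hf
      rcases s with i | t
      · refine ⟨0, ?_⟩
        rw [map_zero, eq_comm, Ideal.Quotient.eq_zero_iff_mem]
        exact Ideal.mul_mem_left _ _ (Ideal.subset_span ⟨i, rfl⟩)
      · exact ⟨f' * X t, by rw [map_mul, hf, map_mul]; simp⟩
  have h := ringKrullDim_le_of_surjective _ hsurj
  rwa [MvPolynomial.ringKrullDim_of_isNoetherianRing, ringKrullDim_eq_zero_of_field, zero_add,
    Nat.card_fin] at h

/-- The support of `T/𝔪T` is `V(Ann T) ∩ V(𝔪)`, which is also the support of `A/(Ann T + 𝔪)`. -/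
theorem fibreDim_eq_ringKrullDim {K : Type*} [Field K] {n m : ℕ} (T : Type*) [AddCommGroup T]
    [Module (PolyA K n m) T] [Module.Finite (PolyA K n m) T] :
    fibreDim K n m T =
      ringKrullDim (PolyA K n m ⧸ (Module.annihilator (PolyA K n m) T ⊔ idealX K n m)) := by
  rw [← Module.supportDim_quotient_eq_ringKrullDim, fibreDim, Module.supportDim,
    Module.supportDim, Module.support_quotient, Module.support_eq_zeroLocus,
    Module.support_eq_zeroLocus, Ideal.annihilator_quotient, PrimeSpectrum.zeroLocus_sup]

/-! ### Slices of bigraded modules, their stabilisation and filtrations with cyclic quotients. -/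

section Module

set_option linter.unusedSectionVars false

variable {K : Type*} [Field K] {n m : ℕ} (p : Fin m → ℕ) {V : Type*} [AddCommGroup V]
  [Module K V] [Module (PolyA K n m) V] [IsScalarTower K (PolyA K n m) V]
  {𝒱 : ℤ × ℤ → Submodule K V} (G : GradedProj 𝒱)
  (hsmul : ∀ c e, ∀ a ∈ gradingA K n p c, ∀ v ∈ 𝒱 e, a • v ∈ 𝒱 (c + e))

include G hsmul in
theorem exists_homogeneous_expansion {s : Finset V} {e : V → ℤ × ℤ} (he : ∀ z ∈ s, z ∈ 𝒱 (e z))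
    {c : ℤ × ℤ} {v : V} (hv : v ∈ 𝒱 c) (hvs : v ∈ Submodule.span (PolyA K n m) (s : Set V)) :
    ∃ a : V → PolyA K n m, (∀ z, a z ∈ gradingA K n p (c - e z)) ∧ ∑ z ∈ s, a z • z = v := by
  obtain ⟨f, -, hf⟩ := Submodule.mem_span_finset.1 hvs
  refine ⟨fun z => (projA K n p).π (c - e z) (f z), fun z => (projA K n p).mem _ _, ?_⟩
  rw [← G.same c v hv, ← hf, map_sum]
  exact Finset.sum_congr rfl fun z hz => (G.π_smul (projA K n p) hsmul (he z hz) c (f z)).symm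

include G hsmul in
theorem finiteDimensional_of_finite [Module.Finite (PolyA K n m) V] (c : ℤ × ℤ) :
    FiniteDimensional K (𝒱 c) := by
  classical
  obtain ⟨s, hs, hspan⟩ := GradedProj.IsHomog.exists_finset
    (G.isHomog_top (R := PolyA K n m)) Module.Finite.fg_top
  choose! e he using fun z hz => (hs z hz).2
  have hle : 𝒱 c ≤ s.sup fun z => (gradingA K n p (c - e z)).map
      ((LinearMap.toSpanSingleton (PolyA K n m) V z).restrictScalars K) := by
    intro v hv
    obtain ⟨a, ha, rfl⟩ := exists_homogeneous_expansion p G hsmul he hv (hspan ▸ trivial)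
    exact Submodule.sum_mem _ fun z hz =>
      Finset.le_sup (f := fun z => (gradingA K n p (c - e z)).map
        ((LinearMap.toSpanSingleton (PolyA K n m) V z).restrictScalars K)) hz ⟨a z, ha z, rfl⟩
  exact Submodule.finiteDimensional_of_le hle

/-- The homogeneous elements of `Z` of bidegrees `(*, k)`. -/
def homogSlice (𝒱 : ℤ × ℤ → Submodule K V) (Z : Submodule (PolyA K n m) V) (k : ℤ) : Set V :=
  {z | z ∈ Z ∧ ∃ x, z ∈ 𝒱 (x, k)}

include G hsmul in
-- Beyond the `y`-degrees of the generators, every monomial coefficient in a homogeneous expansion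
-- contains some `y_t`. Splitting off this factor leaves an element of the previous slice.
theorem homogSlice_succ_subset {Z : Submodule (PolyA K n m) V} {s : Finset V} {e : V → ℤ × ℤ}
    (he : ∀ z ∈ s, z ∈ 𝒱 (e z)) (hs : Submodule.span (PolyA K n m) (s : Set V) = Z) {k : ℤ}
    (hk : ∀ z ∈ s, (e z).2 ≤ k) :
    homogSlice 𝒱 Z (k + 1) ⊆ Submodule.span (PolyA K n m) (homogSlice 𝒱 Z k) := by
  rintro v ⟨hvZ, x, hv⟩
  obtain ⟨a, ha, rfl⟩ := exists_homogeneous_expansion p G hsmul he hv (hs ▸ hvZ)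
  refine Submodule.sum_mem _ fun z hz => ?_
  have hz' := hk z hz
  rw [← (a z).support_sum_monomial_coeff, Finset.sum_smul]
  refine Submodule.sum_mem _ fun d hd => ?_
  have hw := ha z (mem_support_iff.1 hd)
  obtain ⟨t, ht⟩ : ∃ t, d (Sum.inr t) ≠ 0 := by
    by_contra! h
    have h2 := congrArg Prod.snd hw
    change (Finsupp.weight (wt n p) d).2 = _ at h2
    rw [weight_wt] at h2
    simp only [h, Nat.cast_zero, Finset.sum_const_zero, Prod.snd_sub] at h2
    omega
  have hd' : d - Finsupp.single (Sum.inr t) 1 + Finsupp.single (Sum.inr t) 1 = d := by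
    apply tsub_add_cancel_of_le
    rw [Finsupp.single_le_iff]
    omega
  set d' := d - Finsupp.single (Sum.inr t) 1
  have hmon : monomial d (coeff d (a z)) =
      (X (Sum.inr t) : PolyA K n m) * monomial d' (coeff d (a z)) := by
    rw [X, monomial_mul, one_mul, add_comm, hd']
  rw [hmon, mul_smul]
  refine Submodule.smul_mem _ _ (Submodule.subset_span ⟨?_, ?_⟩)
  · exact Submodule.smul_mem _ _ (hs ▸ Submodule.subset_span hz)
  · have h1 : monomial d' (coeff d (a z)) ∈ gradingA K n p (Finsupp.weight (wt n p) d') :=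
      isWeightedHomogeneous_monomial (wt n p) d' _ rfl
    have h2 := hsmul _ _ _ h1 _ (he z hz)
    have h3 : Finsupp.weight (wt n p) d' + (((p t : ℤ), (1 : ℤ)) : ℤ × ℤ) = (x, k + 1) - e z := by
      rw [← hw]
      conv_rhs => rw [← hd', map_add]
      congr 1
      rw [Finsupp.weight_single]
      simp
    have h4 : Finsupp.weight (wt n p) d' + e z = (x - p t, k) := by
      rw [Prod.ext_iff] at h3 ⊢
      simp only [Prod.fst_add, Prod.snd_add, Prod.fst_sub, Prod.snd_sub] at h3 ⊢
      constructor <;> linarith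
    rw [h4] at h2
    exact ⟨_, h2⟩

/-- The ideal of all `a` which map the homogeneous elements of `Z` of bidegrees `(*, k)` to `B`. -/
noncomputable def sliceColon (𝒱 : ℤ × ℤ → Submodule K V) (B Z : Submodule (PolyA K n m) V) (k : ℤ) :
    Ideal (PolyA K n m) :=
  ⨅ z ∈ homogSlice 𝒱 Z k, colonIdeal B z

theorem mem_sliceColon {B Z : Submodule (PolyA K n m) V} {k : ℤ} {a : PolyA K n m} :
    a ∈ sliceColon 𝒱 B Z k ↔ ∀ z ∈ homogSlice 𝒱 Z k, a • z ∈ B := by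
  simp [sliceColon, mem_colonIdeal]

theorem smul_mem_of_mem_sliceColon {B Z : Submodule (PolyA K n m) V} {k : ℤ} {a : PolyA K n m}
    (ha : a ∈ sliceColon 𝒱 B Z k) {v : V}
    (hv : v ∈ Submodule.span (PolyA K n m) (homogSlice 𝒱 Z k)) : a • v ∈ B := by
  have : Submodule.span (PolyA K n m) (homogSlice 𝒱 Z k) ≤ B.comap (LinearMap.lsmul _ _ a) :=
    Submodule.span_le.2 (mem_sliceColon.1 ha)
  exact this hv

include G hsmul in
-- Adding the elements of `s` to `B` one at a time gives quotients `A/(Q : z)` up to a shift. The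
-- ideals `Q : z` contain `J` because `Q` contains `B`.
theorem hasPolyCoeffs_of_chain [∀ c, FiniteDimensional K (𝒱 c)] {B : Submodule (PolyA K n m) V}
    (hB : G.IsHomog B) {J : Ideal (PolyA K n m)} {D δ : ℕ}
    (hJ : ∀ I, (projA K n p).IsHomog I → J ≤ I → HasPolyCoeffs D δ (hilbQuot p I)) (s : Finset V)
    (hs : ∀ z ∈ s, (∃ c, z ∈ 𝒱 c) ∧ J ≤ colonIdeal B z) :
    HasPolyCoeffs D δ fun c => (Module.finrank K
      (𝒱 c ⊓ (B ⊔ Submodule.span (PolyA K n m) (s : Set V)).restrictScalars K : Submodule K V) : ℤ) -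
        Module.finrank K (𝒱 c ⊓ B.restrictScalars K : Submodule K V) := by
  classical
  suffices h : G.IsHomog (B ⊔ Submodule.span (PolyA K n m) (s : Set V)) ∧ HasPolyCoeffs D δ
      fun c => (Module.finrank K (𝒱 c ⊓ (B ⊔ Submodule.span (PolyA K n m) (s : Set V)).restrictScalars
        K : Submodule K V) : ℤ) -
        Module.finrank K (𝒱 c ⊓ B.restrictScalars K : Submodule K V) from h.2
  induction s using Finset.induction_on with
  | empty =>
    have h : B ⊔ Submodule.span (PolyA K n m) ((∅ : Finset V) : Set V) = B := by simp
    rw [h]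
    simp only [sub_self]
    exact ⟨hB, HasPolyCoeffs.zero D δ⟩
  | insert z s hz ih =>
    obtain ⟨ih1, ih2⟩ := ih fun z hz => hs z (Finset.mem_insert_of_mem hz)
    obtain ⟨⟨e, he⟩, hzJ⟩ := hs z (Finset.mem_insert_self z s)
    have hins : B ⊔ Submodule.span (PolyA K n m) ((insert z s : Finset V) : Set V) =
        B ⊔ Submodule.span (PolyA K n m) (s : Set V) ⊔ Submodule.span (PolyA K n m) {z} := by
      rw [Finset.coe_insert, Submodule.span_insert, sup_assoc, sup_comm (Submodule.span _ {z})]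
    set Q := B ⊔ Submodule.span (PolyA K n m) (s : Set V)
    rw [hins]
    refine ⟨ih1.sup_span_singleton hsmul he (projA K n p), ?_⟩
    have h2 := (hJ (colonIdeal Q z) (ih1.colonIdeal (projA K n p) hsmul he)
      (hzJ.trans fun a ha => Submodule.mem_sup_left (mem_colonIdeal.1 ha))).translate e
    convert ih2.add h2 using 1
    funext c
    have := G.finrank_sup_span_singleton (projA K n p) hsmul ih1 he c
    simp only [Pi.add_apply, hilbQuot]
    omega

include G hsmul in
-- Past the degrees of the generators each slice generates the next, so the ideals `sliceColon`
-- increase with `k` and become stationary.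
theorem exists_stable_slice [Module.Finite (PolyA K n m) V] {B Z : Submodule (PolyA K n m) V}
    (hZ : G.IsHomog Z) :
    ∃ k₁ : ℤ, ∀ k ≥ k₁, sliceColon 𝒱 B Z k = sliceColon 𝒱 B Z k₁ ∧
      homogSlice 𝒱 Z k ⊆ Submodule.span (PolyA K n m) (homogSlice 𝒱 Z k₁) := by
  classical
  have := isNoetherian_of_isNoetherianRing_of_finite (PolyA K n m) V
  obtain ⟨s, hs, hspan⟩ := hZ.exists_finset (IsNoetherian.noetherian Z)
  choose! e he using fun z hz => (hs z hz).2
  obtain ⟨k₀, hk₀⟩ : ∃ k₀ : ℤ, ∀ z ∈ s, (e z).2 ≤ k₀ := by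
    obtain ⟨M, hM⟩ := (s.image fun z => (e z).2).bddAbove
    exact ⟨M, fun z hz => hM (Finset.mem_image_of_mem _ hz)⟩
  have hsucc : ∀ k ≥ k₀, homogSlice 𝒱 Z (k + 1) ⊆
      Submodule.span (PolyA K n m) (homogSlice 𝒱 Z k) := fun k hk =>
    homogSlice_succ_subset p G hsmul he hspan fun z hz => (hk₀ z hz).trans hk
  let f : ℕ →o Ideal (PolyA K n m) := ⟨fun i => sliceColon 𝒱 B Z (k₀ + i),
    monotone_nat_of_le_succ fun i a ha => mem_sliceColon.2 fun z hz =>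
      smul_mem_of_mem_sliceColon ha (hsucc (k₀ + i) (by omega) (by
        convert hz using 2
        push_cast; ring))⟩
  obtain ⟨i, hi⟩ := monotone_stabilizes_iff_noetherian.2
    (inferInstance : IsNoetherian (PolyA K n m) (PolyA K n m)) f
  refine ⟨k₀ + i, fun k hk => ⟨?_, ?_⟩⟩
  · have := hi (k - k₀).toNat (by omega)
    change sliceColon 𝒱 B Z _ = sliceColon 𝒱 B Z _ at this
    rw [this]
    congr 1
    omega
  · induction k, hk using Int.leInduction with
    | base => exact Submodule.subset_span
    | succ k hk ih => exact (hsucc k (by omega)).trans (Submodule.span_le.2 ih)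

end Module

/-! ### Hilbert coefficients of the slices of a subquotient. -/

theorem numCoeff_eq_zero {K : Type*} [Field K] {n : ℕ} (T : Type*) [AddCommGroup T]
    [Module (PolyS K n) T] [Subsingleton T] (i : ℕ) : numCoeff (K := K) n T i = 0 := by
  rw [numCoeff, Module.supportDim_eq_bot_of_subsingleton, WithBot.bot_add, WithBot.unbotD_bot]
  rfl

theorem numCoeff_eq {K : Type*} [Field K] {n : ℕ} {T : Type*} [AddCommGroup T]
    [Module (PolyS K n) T] {D : ℕ} (h : Module.supportDim (PolyS K n) T = (D : WithBot ℕ∞))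
    (i : ℕ) : numCoeff (K := K) n T i = D + i := by
  rw [numCoeff, h]
  norm_cast

theorem isHilbertCoeff_zero {K : Type*} [Field K] {n : ℕ} (T : Type*) [AddCommGroup T]
    [Module K T] [Module (PolyS K n) T] [Subsingleton T] (𝒯 : ℤ → Submodule K T) (i j : ℕ) :
    IsHilbertCoeff n 𝒯 i j 0 := by
  refine ⟨0, ⟨Eventually.of_forall fun x => ?_, fun _ _ => rfl⟩, by simp⟩
  rw [numCoeff_eq_zero, iterHilbert_eq_sumOp, binomExpansion_zero]
  exact iterate_sumOp_eq_zero (b := x + 1)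
    (fun y _ => by rw [Module.finrank_zero_of_subsingleton, Nat.cast_zero]) i x (by omega)

/-- Here `D` has to be the exact dimension, since it fixes the number of terms. The sequence `c` is
cut off because the coefficients beyond `D + i - 1` are zero by convention. -/
theorem IterCoeffs.isHilbertCoeff {K : Type*} [Field K] {n : ℕ} {T : Type*} [AddCommGroup T]
    [Module K T] [Module (PolyS K n) T] {𝒯 : ℤ → Submodule K T} {D : ℕ}
    (hD : Module.supportDim (PolyS K n) T = (D : WithBot ℕ∞)) {c : ℕ → ℤ}
    (h : IterCoeffs (fun x => (Module.finrank K (𝒯 x) : ℤ)) D c) (i j : ℕ) :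
    IsHilbertCoeff n 𝒯 i j (if j < D + i then c j else 0 : ℤ) := by
  refine ⟨fun j => if j < D + i then c j else 0, ⟨?_, fun j hj => ?_⟩, rfl⟩
  · filter_upwards [h.2 i] with x hx
    rw [iterHilbert_eq_sumOp, hx, numCoeff_eq hD]
    exact binomExpansion_congr (fun j hj => (if_pos hj).symm) x
  · rw [numCoeff_eq hD] at hj
    exact if_neg (by omega)

theorem natDegree_bounds {q : Polynomial ℚ} {δ j : ℕ} (hq : q ∈ Polynomial.degreeLT ℚ (δ + j))
    (h : q ≠ 0) : q.natDegree + 1 ≤ δ + j := by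
  rw [Polynomial.mem_degreeLT, ← Polynomial.natDegree_lt_iff_degree_lt h] at hq
  exact hq

/-- The Hilbert coefficients of graded `S`-modules `H k` which have the Hilbert functions and the
annihilators of the components of a subquotient `Z / B` of a bigraded `A`-module. -/
theorem exists_polynomial_isHilbertCoeff {K : Type*} [Field K] {n m : ℕ} (p : Fin m → ℕ)
    {V : Type*} [AddCommGroup V] [Module K V] [Module (PolyA K n m) V]
    [IsScalarTower K (PolyA K n m) V] [Module.Finite (PolyA K n m) V]
    {𝒱 : ℤ × ℤ → Submodule K V} (G : GradedProj 𝒱)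
    (hsmul : ∀ c e, ∀ a ∈ gradingA K n p c, ∀ v ∈ 𝒱 e, a • v ∈ 𝒱 (c + e))
    {B Z : Submodule (PolyA K n m) V} (hB : G.IsHomog B) (hZ : G.IsHomog Z) (hBZ : B ≤ Z)
    {T : Type*} [AddCommGroup T] [Module (PolyA K n m) T] [Module.Finite (PolyA K n m) T]
    (hT : ∀ a : PolyA K n m, a ∈ Module.annihilator (PolyA K n m) T ↔ ∀ z ∈ Z, a • z ∈ B)
    {H : ℤ → Type*} [∀ k, AddCommGroup (H k)] [∀ k, Module K (H k)]
    [∀ k, Module (PolyS K n) (H k)] [∀ k, Module.Finite (PolyS K n) (H k)]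
    (ℋ : ∀ k, ℤ → Submodule K (H k))
    (hann : ∀ k, ∀ f : PolyS K n, f ∈ Module.annihilator (PolyS K n) (H k) ↔
      ∀ z ∈ homogSlice 𝒱 Z k, algebraMap (PolyS K n) (PolyA K n m) f • z ∈ B)
    (hrank : ∀ k x, Module.finrank K (ℋ k x) +
        Module.finrank K (𝒱 (x, k) ⊓ B.restrictScalars K : Submodule K V) =
      Module.finrank K (𝒱 (x, k) ⊓ Z.restrictScalars K : Submodule K V)) (i j : ℕ) :
    ∃ q : Polynomial ℚ,
      (∀ᶠ k : ℤ in atTop, IsHilbertCoeff n (ℋ k) i j (q.eval (k : ℚ))) ∧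
      (q ≠ 0 → (q.natDegree : ℤ) ≤ m - 1 + j) ∧
      (q ≠ 0 → (q.natDegree : WithBot ℕ∞) + 1 ≤ fibreDim K n m T + j) := by
  classical
  have hfd := finiteDimensional_of_finite p G hsmul
  obtain ⟨k₁, hk₁⟩ := exists_stable_slice p G hsmul (B := B) hZ
  set J := sliceColon 𝒱 B Z k₁
  have hannJ : ∀ k ≥ k₁, Module.annihilator (PolyS K n) (H k) =
      J.comap (algebraMap (PolyS K n) (PolyA K n m)) := by
    intro k hk
    ext f
    rw [hann, Ideal.mem_comap, ← (hk₁ k hk).1, mem_sliceColon]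
  -- In this case the modules `H k` vanish for large `k`. Otherwise they all have the dimension `D`
  -- of `S/(J ∩ S)`.
  by_cases hJ : J.comap (algebraMap (PolyS K n) (PolyA K n m)) = ⊤
  · refine ⟨0, ?_, fun h => absurd rfl h, fun h => absurd rfl h⟩
    filter_upwards [eventually_ge_atTop k₁] with k hk
    have : Subsingleton (H k) := Module.annihilator_eq_top_iff.1 ((hannJ k hk).trans hJ)
    rw [Polynomial.eval_zero]
    exact isHilbertCoeff_zero _ _ _ _
  obtain ⟨D, hD⟩ := exists_ringKrullDim_quotient_eq hJ
  have hTJ : Module.annihilator (PolyA K n m) T ≤ J := fun a ha =>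
    mem_sliceColon.2 fun z hz => (hT a).1 ha z hz.1
  have hThom : (projA K n p).IsHomog (Module.annihilator (PolyA K n m) T) := by
    intro a ha c
    rw [hT] at ha ⊢
    suffices h : Z ≤ B.comap (LinearMap.lsmul (PolyA K n m) V ((projA K n p).π c a)) from h
    refine hZ.le_of_forall fun e z hz hzZ => ?_
    have h := hB _ (ha z hzZ) (c + e)
    rwa [G.π_smul (projA K n p) hsmul hz, add_sub_cancel_right] at h
  have hTtop : Module.annihilator (PolyA K n m) T ⊔ idealX K n m ≠ ⊤ := by
    intro h
    refine irrelevant_ne_top (K := K) (n := n) (m := m)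
      (top_le_iff.1 (h ▸ sup_le (hThom.le_irrelevant p fun h' => hJ ?_) idealX_le_irrelevant))
    rw [h', top_le_iff] at hTJ
    rw [hTJ, Ideal.comap_top]
  obtain ⟨δ, hδ⟩ := exists_ringKrullDim_quotient_eq hTtop
  have hδm : δ ≤ m := by
    have := (ringKrullDim_quotient_mono
      (le_sup_right : _ ≤ Module.annihilator (PolyA K n m) T ⊔ idealX K n m)).trans
      (ringKrullDim_quotient_idealX_le K n m)
    rw [hδ] at this
    exact_mod_cast this
  -- The chain starts from generators in the slice `k₁` and not from generators of all of `Z`. Only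
  -- so do the colon ideals contain `J`, which bounds the dimensions by `D`; low slices of `Z / B`
  -- could have larger dimension.
  obtain ⟨s, hsX, hs⟩ := (Submodule.fg_span_iff_fg_span_finset_subset
    (R := PolyA K n m) (homogSlice 𝒱 Z k₁)).1 (by
      have := isNoetherian_of_isNoetherianRing_of_finite (PolyA K n m) V
      exact IsNoetherian.noetherian _)
  obtain ⟨c, hc, hcj⟩ := hasPolyCoeffs_of_chain p G hsmul hB (J := J) (D := D) (δ := δ)
    (fun I hI hJI => hasPolyCoeffs_hilbQuot p I hI D δ
      ((ringKrullDim_quotient_mono (Ideal.comap_mono hJI)).trans hD.le)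
      ((ringKrullDim_quotient_mono (sup_le_sup_right (hTJ.trans hJI) _)).trans hδ.le)) s
    (fun z hz => ⟨(hsX hz).2.imp' (fun x => (x, k₁)) fun _ h => h,
      fun a ha => mem_colonIdeal.2 (mem_sliceColon.1 ha z (hsX hz))⟩)
  rw [← hs] at hc
  have hrank' : ∀ k ≥ k₁, ∀ x, (Module.finrank K (ℋ k x) : ℤ) =
      (Module.finrank K (𝒱 (x, k) ⊓ (B ⊔ Submodule.span (PolyA K n m)
        (homogSlice 𝒱 Z k₁)).restrictScalars K : Submodule K V) : ℤ) -
        Module.finrank K (𝒱 (x, k) ⊓ B.restrictScalars K : Submodule K V) := by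
    intro k hk x
    have h1 : (𝒱 (x, k) ⊓ (B ⊔ Submodule.span (PolyA K n m)
        (homogSlice 𝒱 Z k₁)).restrictScalars K : Submodule K V) =
        (𝒱 (x, k) ⊓ Z.restrictScalars K : Submodule K V) := by
      refine le_antisymm (fun v hv => ⟨hv.1, ?_⟩) fun v hv =>
        ⟨hv.1, Submodule.mem_sup_right ((hk₁ k hk).2 ⟨hv.2, x, hv.1⟩)⟩
      exact (sup_le hBZ (Submodule.span_le.2 fun z hz => hz.1) :
        B ⊔ Submodule.span (PolyA K n m) (homogSlice 𝒱 Z k₁) ≤ Z) hv.2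
    rw [h1]
    have := hrank k x
    omega
  have hcoeff : ∀ k ≥ k₁, IsHilbertCoeff n (ℋ k) i j (if j < D + i then c k j else 0 : ℤ) := by
    intro k hk
    refine IterCoeffs.isHilbertCoeff ?_ ?_ i j
    · rw [Module.supportDim_eq_ringKrullDim_quotient_annihilator, hannJ k hk, hD]
    · convert hc k using 1
      funext x
      exact hrank' k hk x
  -- The cut-off `j < D + i` does not depend on `k`, so it preserves eventual polynomiality.
  obtain ⟨q, hq, hqk⟩ : EventuallyPoly (δ + j) fun k => if j < D + i then c k j else 0 := by
    by_cases h : j < D + i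
    · simpa only [if_pos h] using hcj j
    · simp only [if_neg h]
      exact EventuallyPoly.zero _
  refine ⟨q, ?_, fun h => ?_, fun h => ?_⟩
  · filter_upwards [hqk, eventually_ge_atTop k₁] with k h1 h2
    rw [← h1]
    exact hcoeff k h2
  · have := natDegree_bounds hq h
    omega
  · rw [fibreDim_eq_ringKrullDim, hδ]
    exact_mod_cast natDegree_bounds hq h

/-! ### The slices `N_k` as finitely generated `S`-modules. -/

theorem algebraMap_mem_gradingA {K : Type*} [Field K] {n m : ℕ} (p : Fin m → ℕ) {x : ℤ}
    {f : PolyS K n} (hf : f ∈ gradingS K n x) :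
    algebraMap (PolyS K n) (PolyA K n m) f ∈ gradingA K n p (x, 0) := by
  rw [← f.support_sum_monomial_coeff, map_sum]
  refine Submodule.sum_mem _ fun d hd => ?_
  have h := hf (mem_support_iff.1 hd)
  have : algebraMap (PolyS K n) (PolyA K n m) (monomial d (coeff d f)) =
    monomial (d.mapDomain Sum.inl) (coeff d f) := rename_monomial _ _ _
  rw [this]
  refine isWeightedHomogeneous_monomial (wt n p) _ _ ?_
  rw [weight_wt, ← h, Finsupp.weight_apply, Finsupp.sum_fintype _ _ (by simp)]
  have h1 : ∀ i, d.mapDomain (Sum.inl : Fin n → Fin n ⊕ Fin m) (Sum.inl i) = d i := fun i =>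
    Finsupp.mapDomain_apply Sum.inl_injective _ _
  have h2 : ∀ t, d.mapDomain (Sum.inl : Fin n → Fin n ⊕ Fin m) (Sum.inr t) = 0 := fun t =>
    Finsupp.mapDomain_of_notMem_range _ _ (by simp)
  simp [h1, h2]

section Component

variable {K : Type*} [Field K] {n m : ℕ} {p : Fin m → ℕ} {N : Type*} [AddCommGroup N]
  [Module K N] [Module (PolyS K n) N] [Module (PolyA K n m) N]
  [IsScalarTower K (PolyS K n) N] [IsScalarTower K (PolyA K n m) N]
  [IsScalarTower (PolyS K n) (PolyA K n m) N]
  (𝓝 : ℤ × ℤ → Submodule K N) [SetLike.GradedSMul (gradingA K n p) 𝓝]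

omit [Module (PolyS K n) N] [IsScalarTower K (PolyS K n) N] [IsScalarTower K (PolyA K n m) N]
  [IsScalarTower (PolyS K n) (PolyA K n m) N] in
theorem smul_mem_of_gradedSMul (c e : ℤ × ℤ) :
    ∀ a ∈ gradingA K n p c, ∀ v ∈ 𝓝 e, a • v ∈ 𝓝 (c + e) :=
  fun _ ha _ hv => SetLike.GradedSMul.smul_mem ha hv

omit [IsScalarTower K (PolyA K n m) N] in
theorem mem_component_of_mem {x k : ℤ} {u : N} (hu : u ∈ 𝓝 (x, k)) :
    u ∈ component (n := n) p 𝓝 k :=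
  Submodule.mem_iSup_of_mem (p := fun x => 𝓝 (x, k)) x hu

/-- Over `S`, the slice lies in the span of the products of generators of `N` with `y`-monomials.
The second degree bounds the exponents, so finitely many products suffice. -/
theorem finite_component [Module.Finite (PolyA K n m) N] (G : GradedProj 𝓝) (k : ℤ) :
    Module.Finite (PolyS K n) (component (n := n) p 𝓝 k) := by
  classical
  obtain ⟨s, hs, hspan⟩ := GradedProj.IsHomog.exists_finset
    (G.isHomog_top (R := PolyA K n m)) Module.Finite.fg_top
  choose! e he using fun z hz => (hs z hz).2
  let X : Set N := ⋃ z ∈ s, (fun d : Fin m →₀ ℕ =>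
    (rename (Sum.inr : Fin m → Fin n ⊕ Fin m) (monomial d (1 : K)) : PolyA K n m) • z) ''
      Set.Iic (Finsupp.equivFunOnFinite.symm fun _ => (k - (e z).2).toNat)
  have hX : X.Finite := s.finite_toSet.biUnion fun z _ => (Set.finite_Iic _).image _
  have hle : component (n := n) p 𝓝 k ≤ Submodule.span (PolyS K n) X := by
    intro v hv
    change v ∈ ⨆ x, 𝓝 (x, k) at hv
    induction hv using Submodule.iSup_induction' with
    | zero => exact Submodule.zero_mem _
    | add u v _ _ hu hv => exact Submodule.add_mem _ hu hv
    | mem x v hv =>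
      obtain ⟨a, ha, rfl⟩ := exists_homogeneous_expansion (n := n) p G (smul_mem_of_gradedSMul 𝓝) he hv
        (by rw [hspan]; trivial)
      refine Submodule.sum_mem _ fun z hz => ?_
      rw [← (a z).support_sum_monomial_coeff, Finset.sum_smul]
      refine Submodule.sum_mem _ fun d hd => ?_
      have hw := ha z (mem_support_iff.1 hd)
      change Finsupp.weight (wt n p) d = _ at hw
      let d₁ : Fin n →₀ ℕ := d.comapDomain Sum.inl Sum.inl_injective.injOn
      let d₂ : Fin m →₀ ℕ := d.comapDomain Sum.inr Sum.inr_injective.injOn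
      have hd : d = d₁.mapDomain Sum.inl + d₂.mapDomain Sum.inr := by
        ext u
        rcases u with i | t
        · rw [Finsupp.add_apply, Finsupp.mapDomain_apply Sum.inl_injective,
            Finsupp.mapDomain_of_notMem_range _ _ (by simp), add_zero]
          rfl
        · rw [Finsupp.add_apply, Finsupp.mapDomain_apply Sum.inr_injective,
            Finsupp.mapDomain_of_notMem_range _ _ (by simp), zero_add]
          rfl
      have hmul : (monomial d (coeff d (a z)) : PolyA K n m) =
          algebraMap (PolyS K n) (PolyA K n m) (monomial d₁ (coeff d (a z))) *
            rename Sum.inr (monomial d₂ (1 : K)) := by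
        change _ = rename Sum.inl _ * _
        rw [rename_monomial, rename_monomial, monomial_mul, mul_one, ← hd]
      rw [hmul, mul_smul, algebraMap_smul]
      refine Submodule.smul_mem _ _ (Submodule.subset_span ?_)
      refine Set.mem_biUnion hz ⟨d₂, fun t => ?_, rfl⟩
      rw [weight_wt] at hw
      have h2 := congrArg Prod.snd hw
      simp only [Prod.snd_sub] at h2
      have h1 := Finset.single_le_sum (f := fun i => (d (Sum.inr i) : ℤ))
        (fun _ _ => by positivity) (Finset.mem_univ t)
      change d (Sum.inr t) ≤ (k - (e z).2).toNat
      omega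
  have := isNoetherian_of_fg_of_noetherian _ (Submodule.fg_span (R := PolyS K n) hX)
  have := isNoetherian_of_le hle
  infer_instance

end Component

/-! ### Annihilators and Hilbert functions of homology, and passage to slices. -/

section Homology

theorem mem_annihilator_homology {R U V W : Type*} [CommRing R] [AddCommGroup U] [AddCommGroup V]
    [AddCommGroup W] [Module R U] [Module R V] [Module R W] (f : U →ₗ[R] V) (g : V →ₗ[R] W)
    (a : R) : a ∈ Module.annihilator R (Homology f g) ↔
      ∀ v ∈ LinearMap.ker g, a • v ∈ LinearMap.range f := by
  rw [Module.mem_annihilator]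
  constructor
  · intro h v hv
    have := h (Submodule.Quotient.mk ⟨v, hv⟩)
    rw [← Submodule.Quotient.mk_smul, Submodule.Quotient.mk_eq_zero] at this
    exact this
  · intro h y
    obtain ⟨⟨v, hv⟩, rfl⟩ := Submodule.Quotient.mk_surjective _ y
    rw [← Submodule.Quotient.mk_smul, Submodule.Quotient.mk_eq_zero]
    exact h v hv

theorem finrank_homologyGrading {K R U V W : Type*} [Field K] [CommRing R] [Algebra K R]
    [AddCommGroup U] [AddCommGroup V]
    [AddCommGroup W] [Module R U] [Module R V] [Module R W] [Module K V] [IsScalarTower K R V]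
    (f : U →ₗ[R] V) (g : V →ₗ[R] W) (hgf : ∀ u, g (f u) = 0) (𝒱 : ℤ → Submodule K V) (c : ℤ)
    [FiniteDimensional K (𝒱 c)] :
    Module.finrank K (homologyGrading f g 𝒱 c) +
        Module.finrank K (𝒱 c ⊓ (LinearMap.range f).restrictScalars K : Submodule K V) =
      Module.finrank K (𝒱 c ⊓ (LinearMap.ker g).restrictScalars K : Submodule K V) := by
  let σ := (LinearMap.ker g).subtype.restrictScalars K
  have hσ : Function.Injective σ := Subtype.val_injective
  let Q := (𝒱 c).comap σ
  have hfd : FiniteDimensional K Q :=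
    FiniteDimensional.of_injective (σ.restrict (p := Q) (q := 𝒱 c) fun _ h => h)
      fun x y h => Subtype.ext (hσ
        (show σ x.1 = σ y.1 from congrArg (fun u : 𝒱 c => (u : V)) h))
  have h := finrank_map_add_finrank_inf_ker
    (((LinearMap.range f).submoduleOf (LinearMap.ker g)).mkQ.restrictScalars K) Q
  have h1 : Q.map σ = 𝒱 c ⊓ (LinearMap.ker g).restrictScalars K := by
    ext v
    constructor
    · rintro ⟨⟨v, hv⟩, h, rfl⟩
      exact ⟨h, hv⟩
    · rintro ⟨h, hv⟩
      exact ⟨⟨v, hv⟩, h, rfl⟩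
  have h2 : (Q ⊓ LinearMap.ker (((LinearMap.range f).submoduleOf
      (LinearMap.ker g)).mkQ.restrictScalars K)).map σ =
        𝒱 c ⊓ (LinearMap.range f).restrictScalars K := by
    ext v
    constructor
    · rintro ⟨⟨v, hv⟩, ⟨h, h'⟩, rfl⟩
      have h' : (Submodule.Quotient.mk ⟨v, hv⟩ : Homology f g) = 0 := h'
      rw [Submodule.Quotient.mk_eq_zero] at h'
      exact ⟨h, h'⟩
    · rintro ⟨h, hv⟩
      refine ⟨⟨v, ?_⟩, ⟨h, (Submodule.Quotient.mk_eq_zero _).2 hv⟩, rfl⟩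
      obtain ⟨u, rfl⟩ := hv
      exact hgf u
  rw [← h1, ← h2, ← (Submodule.equivMapOfInjective σ hσ _).finrank_eq,
    ← (Submodule.equivMapOfInjective σ hσ _).finrank_eq]
  exact h

end Homology

/-- The Hilbert coefficients of the homology of complexes `V'_k → V_k → V''_k` of graded
`S`-modules which are the components of a complex `V' → V → V''` of bigraded `A`-modules. -/
theorem exists_polynomial_isHilbertCoeff_homology {K : Type*} [Field K] {n m : ℕ} (p : Fin m → ℕ)
    {V' V V'' : Type*} [AddCommGroup V'] [AddCommGroup V] [AddCommGroup V'']
    [Module K V'] [Module K V] [Module K V'']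
    [Module (PolyS K n) V'] [Module (PolyS K n) V] [Module (PolyS K n) V'']
    [Module (PolyA K n m) V'] [Module (PolyA K n m) V] [Module (PolyA K n m) V'']
    [IsScalarTower K (PolyS K n) V] [IsScalarTower K (PolyA K n m) V]
    [IsScalarTower (PolyS K n) (PolyA K n m) V] [Module.Finite (PolyA K n m) V]
    {𝒱' : ℤ × ℤ → Submodule K V'} {𝒱 : ℤ × ℤ → Submodule K V} {𝒱'' : ℤ × ℤ → Submodule K V''}
    (G' : GradedProj 𝒱') (G : GradedProj 𝒱) (G'' : GradedProj 𝒱'')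
    (hsmul : ∀ c e, ∀ a ∈ gradingA K n p c, ∀ v ∈ 𝒱 e, a • v ∈ 𝒱 (c + e))
    (f : V' →ₗ[PolyA K n m] V) (g : V →ₗ[PolyA K n m] V'')
    (hf : ∀ c, ∀ v ∈ 𝒱' c, f v ∈ 𝒱 c) (hg : ∀ c, ∀ v ∈ 𝒱 c, g v ∈ 𝒱'' c)
    (hgf : ∀ v, g (f v) = 0)
    {U' U U'' : ℤ → Type*} [∀ k, AddCommGroup (U' k)] [∀ k, AddCommGroup (U k)]
    [∀ k, AddCommGroup (U'' k)] [∀ k, Module K (U k)]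
    [∀ k, Module (PolyS K n) (U' k)] [∀ k, Module (PolyS K n) (U k)]
    [∀ k, Module (PolyS K n) (U'' k)] [∀ k, IsScalarTower K (PolyS K n) (U k)]
    [∀ k, Module.Finite (PolyS K n) (U k)] (𝒰 : ∀ k, ℤ → Submodule K (U k))
    (f' : ∀ k, U' k →ₗ[PolyS K n] U k) (g' : ∀ k, U k →ₗ[PolyS K n] U'' k)
    (ι' : ∀ k, U' k →ₗ[PolyS K n] V') (ι : ∀ k, U k →ₗ[PolyS K n] V)
    (ι'' : ∀ k, U'' k →ₗ[PolyS K n] V'')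
    (hι : ∀ k, Function.Injective (ι k)) (hι'' : ∀ k, Function.Injective (ι'' k))
    (hfι : ∀ k u, f (ι' k u) = ι k (f' k u)) (hgι : ∀ k u, g (ι k u) = ι'' k (g' k u))
    (hι' : ∀ k x, ∀ v ∈ 𝒱' (x, k), ∃ u, ι' k u = v)
    (h𝒰 : ∀ k x, (𝒰 k x).map ((ι k).restrictScalars K) = 𝒱 (x, k))
    (hπ : ∀ k u c, c.2 ≠ k → G.π c (ι k u) = 0) (i j : ℕ) :
    ∃ q : Polynomial ℚ,
      (∀ᶠ k : ℤ in atTop,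
        IsHilbertCoeff n (homologyGrading (f' k) (g' k) (𝒰 k)) i j (q.eval (k : ℚ))) ∧
      (q ≠ 0 → (q.natDegree : ℤ) ≤ m - 1 + j) ∧
      (q ≠ 0 → (q.natDegree : WithBot ℕ∞) + 1 ≤ fibreDim K n m (Homology f g) + j) := by
  classical
  have hfd := finiteDimensional_of_finite p G hsmul
  have hle : LinearMap.range f ≤ LinearMap.ker g := by
    rintro _ ⟨v, rfl⟩
    exact hgf v
  have hgf' : ∀ k u, g' k (f' k u) = 0 := fun k u => hι'' k (by
    rw [← hgι, ← hfι, hgf, map_zero])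
  have hker : ∀ k u, u ∈ LinearMap.ker (g' k) ↔ ι k u ∈ LinearMap.ker g := fun k u => by
    rw [LinearMap.mem_ker, LinearMap.mem_ker, hgι, (map_eq_zero_iff _ (hι'' k))]
  -- A preimage of `ι k u` under `f` need not come from `U' k`. Its components of second degree `k`
  -- do, and `ι k u` has no components of other second degrees.
  have hrange : ∀ k u, u ∈ LinearMap.range (f' k) ↔ ι k u ∈ LinearMap.range f := by
    intro k u
    constructor
    · rintro ⟨w, rfl⟩
      exact ⟨ι' k w, hfι k w⟩
    · rintro ⟨y, hy⟩
      suffices h : ∃ w, ι k (f' k w) = ι k u from h.imp fun w hw => hι k hw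
      obtain ⟨s, hs⟩ := G.exists_sum_eq (ι k u)
      have h1 : ∀ c : ℤ × ℤ, ∃ w, ι k (f' k w) = G.π c (ι k u) := by
        rintro ⟨x, k'⟩
        rcases eq_or_ne k' k with rfl | hk
        · obtain ⟨w, hw⟩ := hι' k' x _ (G'.mem (x, k') y)
          refine ⟨w, ?_⟩
          rw [← hfι, hw, ← hy, G'.map_π G f hf]
        · exact ⟨0, by rw [map_zero, map_zero, hπ k u _ hk]⟩
      choose w hw using h1
      exact ⟨∑ c ∈ s, w c, by rw [map_sum, map_sum, ← hs]; exact Finset.sum_congr rfl fun c _ => hw c⟩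
  have hfdU : ∀ k x, FiniteDimensional K (𝒰 k x) := fun k x => by
    have := hfd (x, k)
    rw [← h𝒰] at this
    exact (Submodule.equivMapOfInjective ((ι k).restrictScalars K) (hι k) (𝒰 k x)).symm.finiteDimensional
  have hinf : ∀ k x (P : Submodule (PolyS K n) (U k)) (Q : Submodule (PolyA K n m) V),
      (∀ u, u ∈ P ↔ ι k u ∈ Q) →
      Module.finrank K (𝒰 k x ⊓ P.restrictScalars K : Submodule K (U k)) =
        Module.finrank K (𝒱 (x, k) ⊓ Q.restrictScalars K : Submodule K V) := by
    intro k x P Q hPQ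
    have h : (𝒰 k x ⊓ P.restrictScalars K).map ((ι k).restrictScalars K) =
        𝒱 (x, k) ⊓ Q.restrictScalars K := by
      rw [← h𝒰]
      ext v
      constructor
      · rintro ⟨u, ⟨h1, h2⟩, rfl⟩
        exact ⟨⟨u, h1, rfl⟩, (hPQ u).1 h2⟩
      · rintro ⟨⟨u, h1, rfl⟩, h2⟩
        exact ⟨u, ⟨h1, (hPQ u).2 h2⟩, rfl⟩
    rw [(Submodule.equivMapOfInjective ((ι k).restrictScalars K) (hι k) _).finrank_eq, h]
  have := fun k => isNoetherian_of_isNoetherianRing_of_finite (PolyS K n) (U k)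
  have := isNoetherian_of_isNoetherianRing_of_finite (PolyA K n m) V
  refine exists_polynomial_isHilbertCoeff p G hsmul (G'.isHomog_range G f hf)
    (G.isHomog_ker G'' g hg) hle (T := Homology f g) (mem_annihilator_homology f g)
    (H := fun k => Homology (f' k) (g' k)) _ (fun k a => ?_) (fun k x => ?_) i j
  · rw [mem_annihilator_homology]
    constructor
    · rintro h z ⟨hz, x, hx⟩
      rw [← h𝒰] at hx
      obtain ⟨u, hu, rfl⟩ := hx
      have h2 := (hrange k _).1 (h u ((hker k u).2 hz))
      rw [map_smul, ← algebraMap_smul (PolyA K n m)] at h2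
      exact h2
    · intro h u hu
      rw [hrange, map_smul, ← algebraMap_smul (PolyA K n m)]
      obtain ⟨s, hs⟩ := G.exists_sum_eq (ι k u)
      rw [← hs, Finset.smul_sum]
      refine Submodule.sum_mem _ fun c _ => ?_
      by_cases hc : c.2 = k
      · refine h _ ⟨G.isHomog_ker G'' g hg _ ((hker k u).1 hu) c, c.1, ?_⟩
        have e : 𝒱 c = 𝒱 (c.1, k) := by rw [← hc]
        rw [← e]
        exact G.mem c _
      · rw [hπ k u c hc, smul_zero]
        exact Submodule.zero_mem _
  · rw [← hinf k x _ _ (hker k), ← hinf k x _ _ (hrange k)]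
    exact finrank_homologyGrading (f' k) (g' k) (hgf' k) (𝒰 k) x

/-! ### Bigradings on `N ⊗ F` and `Hom(F, N)` for a free module `F`. -/

theorem single_mem_freeGrading {K : Type*} [Field K] {n r : ℕ} (a : Fin r → ℤ) (b : Fin r) :
    (Pi.single b 1 : Fin r → PolyS K n) ∈ freeGrading a (a b) := by
  rw [mem_freeGrading]
  intro b'
  rcases eq_or_ne b' b with rfl | h
  · rw [Pi.single_eq_same, sub_self]
    exact isWeightedHomogeneous_one K _
  · rw [Pi.single_eq_of_ne h]
    exact Submodule.zero_mem _

namespace BigradedHilbert.GradedFreeResolution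

variable {K : Type*} [Field K] {n : ℕ} {M : Type*} [AddCommGroup M] [Module K M]
  [Module (PolyS K n) M] {𝓜 : ℤ → Submodule K M} (F : GradedFreeResolution (n := n) 𝓜)

theorem out_degree (l : ℕ) (c : ℤ) :
    ∀ f ∈ freeGrading (K := K) (F.shift l) c, F.out l f ∈ freeGrading (F.shift (l - 1)) c := by
  rcases l with _ | l
  · intro f _
    exact Submodule.zero_mem _
  · exact F.d_degree l c

theorem out_d (l : ℕ) (f : F.obj (l + 1)) : F.out l (F.d l f) = 0 := by
  rcases l with _ | l
  · rfl
  · exact (F.exact l).apply_apply_eq_zero f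

end BigradedHilbert.GradedFreeResolution

section TorExt

set_option linter.unusedSectionVars false

variable {K : Type*} [Field K] {n m : ℕ} (p : Fin m → ℕ) {N : Type*} [AddCommGroup N]
  [Module K N] [Module (PolyS K n) N] [Module (PolyA K n m) N]
  [IsScalarTower K (PolyS K n) N] [IsScalarTower K (PolyA K n m) N]
  [IsScalarTower (PolyS K n) (PolyA K n m) N]
  (𝓝 : ℤ × ℤ → Submodule K N) [SetLike.GradedSMul (gradingA K n p) 𝓝]

include p in
theorem gradingS_smul_mem {x y k : ℤ} {f : PolyS K n} (hf : f ∈ gradingS K n x) {v : N}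
    (hv : v ∈ 𝓝 (y, k)) : f • v ∈ 𝓝 (x + y, k) := by
  rw [← algebraMap_smul (PolyA K n m)]
  have := smul_mem_of_gradedSMul 𝓝 _ _ _ (algebraMap_mem_gradingA p hf) _ hv
  simpa using this

/-- The bigrading of `N ⊗_S F` for a free module `F`. -/
noncomputable def tensorBigrading {r : ℕ} (a : Fin r → ℤ) (c : ℤ × ℤ) :
    Submodule K (N ⊗[PolyS K n] (Fin r → PolyS K n)) :=
  tensorGrading (fun x => 𝓝 (x, c.2)) (freeGrading a) c.1

/-- The bigrading of `Hom_S(F, N)` for a free module `F`. -/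
noncomputable def homBigrading {r : ℕ} (a : Fin r → ℤ) (c : ℤ × ℤ) :
    Submodule K ((Fin r → PolyS K n) →ₗ[PolyS K n] N) :=
  homGrading (freeGrading a) (fun x => 𝓝 (x, c.2)) c.1

/-- The identification of `N ⊗_S F` with a power of `N`. -/
noncomputable def tensorEquiv (K : Type*) [Field K] (n r : ℕ) (N : Type*) [AddCommGroup N]
    [Module K N] [Module (PolyS K n) N] [IsScalarTower K (PolyS K n) N] :
    N ⊗[PolyS K n] (Fin r → PolyS K n) ≃ₗ[K] (Fin r → N) :=
  (TensorProduct.piScalarRight (PolyS K n) (PolyS K n) N (Fin r)).restrictScalars K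

/-- The identification of `Hom_S(F, N)` with a power of `N`. -/
noncomputable def homEquiv (K : Type*) [Field K] (n r : ℕ) (N : Type*) [AddCommGroup N]
    [Module K N] [Module (PolyS K n) N] [IsScalarTower K (PolyS K n) N] :
    ((Fin r → PolyS K n) →ₗ[PolyS K n] N) ≃ₗ[K] (Fin r → N) :=
  ((Pi.basisFun (PolyS K n) (Fin r)).constr (PolyS K n)).symm.restrictScalars K

theorem tensorEquiv_tmul {r : ℕ} (u : N) (f : Fin r → PolyS K n) (b : Fin r) :
    tensorEquiv K n r N (u ⊗ₜ f) b = f b • u := by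
  simp [tensorEquiv]

theorem tensorEquiv_symm_single {r : ℕ} (u : N) (b : Fin r) :
    (tensorEquiv K n r N).symm (Pi.single b u) = u ⊗ₜ Pi.single b 1 := by
  rw [LinearEquiv.symm_apply_eq]
  funext b'
  rw [tensorEquiv_tmul]
  rcases eq_or_ne b' b with rfl | h
  · simp
  · simp [Pi.single_eq_of_ne h]

theorem homEquiv_apply {r : ℕ} (φ : (Fin r → PolyS K n) →ₗ[PolyS K n] N) (b : Fin r) :
    homEquiv K n r N φ b = φ (Pi.single b 1) := by
  change φ (Pi.basisFun (PolyS K n) (Fin r) b) = _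
  rw [Pi.basisFun_apply]

include p in
-- In coordinates the grading is that of a sum of shifted copies of `N`, so `GradedProj.pi` applies.
-- The shift is by `-a b` here and by `+a b` for `Hom`, where the basis is dualised.
theorem mem_tensorBigrading {r : ℕ} (a : Fin r → ℤ) (c : ℤ × ℤ)
    (w : N ⊗[PolyS K n] (Fin r → PolyS K n)) :
    w ∈ tensorBigrading 𝓝 a c ↔ ∀ b, tensorEquiv K n r N w b ∈ 𝓝 (c + (-a b, 0)) := by
  constructor
  · intro hw b
    induction hw using Submodule.span_induction with
    | zero => rw [map_zero]; exact Submodule.zero_mem _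
    | add u v _ _ hu hv => rw [map_add]; exact Submodule.add_mem _ hu hv
    | smul t u _ hu => rw [map_smul]; exact Submodule.smul_mem _ _ hu
    | mem w hw =>
      obtain ⟨k, u, hu, f, hf, rfl⟩ := hw
      rw [tensorEquiv_tmul]
      have := gradingS_smul_mem p 𝓝 (mem_freeGrading.1 hf b) hu
      convert this using 2
      ext <;> simp
      ring
  · intro h
    have hw : w = ∑ b, (tensorEquiv K n r N).symm (Pi.single b (tensorEquiv K n r N w b)) := by
      rw [← map_sum, Finset.univ_sum_single, LinearEquiv.symm_apply_apply]
    rw [hw]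
    refine Submodule.sum_mem _ fun b _ => ?_
    rw [tensorEquiv_symm_single]
    refine Submodule.subset_span ⟨a b, _, ?_, _, single_mem_freeGrading a b, rfl⟩
    have := h b
    convert this using 2
    ext <;> simp
    ring

theorem hom_apply_eq_sum {r : ℕ} (φ : (Fin r → PolyS K n) →ₗ[PolyS K n] N)
    (u : Fin r → PolyS K n) : φ u = ∑ b, u b • φ (Pi.single b 1) := by
  conv_lhs => rw [pi_eq_sum_univ' u]
  simp [map_sum]

include p in
theorem mem_homBigrading {r : ℕ} (a : Fin r → ℤ) (c : ℤ × ℤ)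
    (φ : (Fin r → PolyS K n) →ₗ[PolyS K n] N) :
    φ ∈ homBigrading 𝓝 a c ↔ ∀ b, homEquiv K n r N φ b ∈ 𝓝 (c + (a b, 0)) := by
  constructor
  · intro h b
    rw [homEquiv_apply]
    have := h _ _ (single_mem_freeGrading a b)
    convert this using 2
    ext <;> simp
    ring
  · intro h k u hu
    rw [hom_apply_eq_sum]
    refine Submodule.sum_mem _ fun b _ => ?_
    have h1 := h b
    rw [homEquiv_apply] at h1
    have := gradingS_smul_mem p 𝓝 (y := c.1 + a b) (k := c.2) (mem_freeGrading.1 hu b) (by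
      convert h1 using 2
      ext <;> simp)
    convert this using 2
    ring

end TorExt

/-! ### Application to the complexes that compute Tor and Ext. -/

section TorExt

variable {K : Type*} [Field K] {n m : ℕ} (p : Fin m → ℕ) {M : Type*} [AddCommGroup M] [Module K M]
  [Module (PolyS K n) M] {𝓜 : ℤ → Submodule K M} (F : GradedFreeResolution (n := n) 𝓜)
  {N : Type*} [AddCommGroup N]
  [Module K N] [Module (PolyS K n) N] [Module (PolyA K n m) N]
  [IsScalarTower K (PolyS K n) N] [IsScalarTower K (PolyA K n m) N]
  [IsScalarTower (PolyS K n) (PolyA K n m) N] [Module.Finite (PolyA K n m) N]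
  {𝓝 : ℤ × ℤ → Submodule K N} [SetLike.GradedSMul (gradingA K n p) 𝓝] (G : GradedProj 𝓝)

/-- The projections of the bigrading of `N ⊗_S F`. -/
noncomputable def tensorProj {r : ℕ} (a : Fin r → ℤ) :
    GradedProj (tensorBigrading (n := n) 𝓝 a) :=
  G.pi (fun b => (-a b, 0)) (tensorEquiv K n r N) _ (mem_tensorBigrading p 𝓝 a)

/-- The projections of the bigrading of `Hom_S(F, N)`. -/
noncomputable def homProj {r : ℕ} (a : Fin r → ℤ) : GradedProj (homBigrading (n := n) 𝓝 a) :=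
  G.pi (fun b => (a b, 0)) (homEquiv K n r N) _ (mem_homBigrading p 𝓝 a)

omit [IsScalarTower K (PolyA K n m) N] [Module.Finite (PolyA K n m) N] in
theorem proj_component {k : ℤ} {u : N} (hu : u ∈ component (n := n) p 𝓝 k) {c : ℤ × ℤ}
    (hc : c.2 ≠ k) : G.π c u = 0 := by
  change u ∈ ⨆ x, 𝓝 (x, k) at hu
  induction hu using Submodule.iSup_induction' with
  | zero => exact map_zero _
  | add u v _ _ hu hv => rw [map_add, hu, hv, add_zero]
  | mem x v hv => exact G.ne _ _ _ hv fun h => hc (by rw [← h])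

include G in
theorem exists_polynomial_tor (l i j : ℕ) :
    ∃ q : Polynomial ℚ,
      (∀ᶠ k : ℤ in atTop, IsHilbertCoeff n
        (torGrading F (componentGrading (n := n) p 𝓝 k) l) i j (q.eval (k : ℚ))) ∧
      (q ≠ 0 → (q.natDegree : ℤ) ≤ m - 1 + j) ∧
      (q ≠ 0 →
        (q.natDegree : WithBot ℕ∞) + 1 ≤ fibreDim K n m (Tor F (PolyA K n m) N l) + j) := by
  have hfin := finite_component (n := n) (p := p) 𝓝 G
  have hmap : ∀ (r r' : ℕ) (a : Fin r → ℤ) (a' : Fin r' → ℤ)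
      (d : (Fin r → PolyS K n) →ₗ[PolyS K n] (Fin r' → PolyS K n))
      (_ : ∀ x, ∀ f ∈ freeGrading (K := K) a x, d f ∈ freeGrading a' x) (c : ℤ × ℤ),
      ∀ v ∈ tensorBigrading (n := n) 𝓝 a c,
        TensorProduct.AlgebraTensorModule.lTensor (PolyA K n m) N d v ∈
          tensorBigrading 𝓝 a' c := by
    intro r r' a a' d hd c v hv
    induction hv using Submodule.span_induction with
    | zero => rw [map_zero]; exact Submodule.zero_mem _
    | add u v _ _ hu hv => rw [map_add]; exact Submodule.add_mem _ hu hv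
    | smul t u _ hu =>
      rw [← algebraMap_smul (PolyA K n m) t u, map_smul, algebraMap_smul]
      exact Submodule.smul_mem _ _ hu
    | mem w hw =>
      obtain ⟨k, u, hu, f, hf, rfl⟩ := hw
      exact Submodule.subset_span ⟨k, u, hu, d f, hd k f hf, rfl⟩
  have hι : ∀ (k x : ℤ) (r : ℕ) (a : Fin r → ℤ),
      (tensorGrading (componentGrading (n := n) p 𝓝 k) (freeGrading a) x).map
        (((component (n := n) p 𝓝 k).subtype.rTensor (Fin r → PolyS K n)).restrictScalars K) =
      tensorBigrading 𝓝 a (x, k) := by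
    intro k x r a
    rw [tensorGrading, Submodule.map_span, tensorBigrading, tensorGrading]
    congr 1
    ext w
    constructor
    · rintro ⟨_, ⟨y, u, hu, f, hf, rfl⟩, rfl⟩
      exact ⟨y, u, hu, f, hf, rfl⟩
    · rintro ⟨y, u, hu, f, hf, rfl⟩
      exact ⟨_, ⟨y, ⟨u, mem_component_of_mem 𝓝 hu⟩, hu, f, hf, rfl⟩, rfl⟩
  -- Free modules are flat, so the inclusion of `N_k` in `N` stays injective after tensoring.
  have hinj : ∀ (k : ℤ) (r : ℕ), Function.Injective
      ((component (n := n) p 𝓝 k).subtype.rTensor (Fin r → PolyS K n)) := fun k r =>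
    Module.Flat.rTensor_preserves_injective_linearMap _ Subtype.val_injective
  have hnat : ∀ (k : ℤ) (r r' : ℕ) (d : (Fin r → PolyS K n) →ₗ[PolyS K n] (Fin r' → PolyS K n))
      (u : component (n := n) p 𝓝 k ⊗[PolyS K n] (Fin r → PolyS K n)),
      TensorProduct.AlgebraTensorModule.lTensor (PolyA K n m) N d
        ((component (n := n) p 𝓝 k).subtype.rTensor _ u) =
      (component (n := n) p 𝓝 k).subtype.rTensor _
        (TensorProduct.AlgebraTensorModule.lTensor (PolyS K n) _ d u) := by
    intro k r r' d u
    induction u using TensorProduct.induction_on with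
    | zero => simp
    | tmul u f => rfl
    | add u v hu hv => simp only [map_add, hu, hv]
  have hfinA : Module.Finite (PolyA K n m) (N ⊗[PolyS K n] F.obj l) := Module.Finite.equiv
    (TensorProduct.piScalarRight (PolyS K n) (PolyA K n m) N (Fin (F.rank l))).symm
  refine exists_polynomial_isHilbertCoeff_homology p (tensorProj p G (F.shift (l + 1)))
    (tensorProj p G (F.shift l)) (tensorProj p G (F.shift (l - 1))) ?_
    (torIn F (PolyA K n m) N l) (torOut F (PolyA K n m) N l) (hmap _ _ _ _ _ (F.d_degree l))
    (hmap _ _ _ _ _ (F.out_degree l)) ?_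
    (fun k => tensorGrading (componentGrading (n := n) p 𝓝 k) (freeGrading (F.shift l)))
    (fun k => torIn F (PolyS K n) (component (n := n) p 𝓝 k) l)
    (fun k => torOut F (PolyS K n) (component (n := n) p 𝓝 k) l)
    (fun k => (component (n := n) p 𝓝 k).subtype.rTensor _)
    (fun k => (component (n := n) p 𝓝 k).subtype.rTensor _)
    (fun k => (component (n := n) p 𝓝 k).subtype.rTensor _)
    (fun k => hinj k _) (fun k => hinj k _) (fun k => hnat k _ _ _) (fun k => hnat k _ _ _)
    ?_ (fun k x => hι k x _ _) ?_ i j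
  · intro c e a ha v hv
    induction hv using Submodule.span_induction with
    | zero => rw [smul_zero]; exact Submodule.zero_mem _
    | add u v _ _ hu hv => rw [smul_add]; exact Submodule.add_mem _ hu hv
    | smul t u _ hu => rw [smul_comm]; exact Submodule.smul_mem _ _ hu
    | mem w hw =>
      obtain ⟨k, u, hu, f, hf, rfl⟩ := hw
      refine Submodule.subset_span ⟨k, a • u, ?_, f, hf, rfl⟩
      have := smul_mem_of_gradedSMul 𝓝 _ _ _ ha _ hu
      convert this using 2
      ext
      · simp only [Prod.fst_add]; ring
      · rfl
  · intro v
    induction v using TensorProduct.induction_on with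
    | zero => simp
    | tmul u f =>
      change u ⊗ₜ[PolyS K n] F.out l (F.d l f) = 0
      rw [F.out_d, TensorProduct.tmul_zero]
    | add u v hu hv => simp only [map_add, hu, hv, add_zero]
  · intro k x v hv
    rw [← hι] at hv
    obtain ⟨u, -, hu⟩ := hv
    exact ⟨u, hu⟩
  · intro k u c hc
    change (tensorEquiv K n _ N).symm _ = 0
    rw [LinearEquiv.symm_apply_eq, map_zero]
    funext b
    change G.π _ (tensorEquiv K n _ N _ b) = 0
    refine proj_component (n := n) p G (k := k) ?_ (by simpa using hc)
    induction u using TensorProduct.induction_on with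
    | zero => simp
    | tmul u f =>
      rw [LinearMap.rTensor_tmul, tensorEquiv_tmul]
      exact Submodule.smul_mem _ _ u.2
    | add u v hu hv =>
      rw [map_add, map_add]
      exact Submodule.add_mem _ hu hv

include G in
theorem exists_polynomial_ext (l i j : ℕ) :
    ∃ q : Polynomial ℚ,
      (∀ᶠ k : ℤ in atTop, IsHilbertCoeff n
        (extGrading F (componentGrading (n := n) p 𝓝 k) l) i j (q.eval (k : ℚ))) ∧
      (q ≠ 0 → (q.natDegree : ℤ) ≤ m - 1 + j) ∧
      (q ≠ 0 →
        (q.natDegree : WithBot ℕ∞) + 1 ≤ fibreDim K n m (Ext F (PolyA K n m) N l) + j) := by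
  have hfin := finite_component (n := n) (p := p) 𝓝 G
  have hmap : ∀ (r r' : ℕ) (a : Fin r → ℤ) (a' : Fin r' → ℤ)
      (d : (Fin r → PolyS K n) →ₗ[PolyS K n] (Fin r' → PolyS K n))
      (_ : ∀ x, ∀ f ∈ freeGrading (K := K) a x, d f ∈ freeGrading a' x) (c : ℤ × ℤ),
      ∀ φ ∈ homBigrading (n := n) 𝓝 a' c,
        LinearMap.lcomp (PolyA K n m) N d φ ∈ homBigrading 𝓝 a c :=
    fun r r' a a' d hd c φ hφ k u hu => hφ k _ (hd k u hu)
  have hι : ∀ (k x : ℤ) (r : ℕ) (a : Fin r → ℤ),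
      (homGrading (freeGrading a) (componentGrading (n := n) p 𝓝 k) x).map
        (((component (n := n) p 𝓝 k).subtype.compRight (PolyS K n)
          (M := Fin r → PolyS K n)).restrictScalars K) =
      homBigrading 𝓝 a (x, k) := by
    intro k x r a
    ext φ
    constructor
    · rintro ⟨ψ, hψ, rfl⟩ y u hu
      exact hψ y u hu
    · intro hφ
      -- A homogeneous `φ` sends the basis of the free module into `N_k`, so it factors through this
      -- `S`-submodule.
      have hmem : ∀ u, φ u ∈ component (n := n) p 𝓝 k := fun u => by
        rw [hom_apply_eq_sum]
        exact Submodule.sum_mem _ fun b _ => Submodule.smul_mem _ _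
          (mem_component_of_mem 𝓝 (hφ _ _ (single_mem_freeGrading a b)))
      exact ⟨φ.codRestrict _ hmem, fun y u hu => hφ y u hu, rfl⟩
  have hinj : ∀ (k : ℤ) (r : ℕ), Function.Injective
      ((component (n := n) p 𝓝 k).subtype.compRight (PolyS K n) (M := Fin r → PolyS K n)) :=
    fun k r φ ψ h => LinearMap.ext fun u => Subtype.ext (LinearMap.congr_fun h u)
  have hfinA : Module.Finite (PolyA K n m) (F.obj l →ₗ[PolyS K n] N) := Module.Finite.equiv
    ((Pi.basisFun (PolyS K n) (Fin (F.rank l))).constr (PolyA K n m))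
  refine exists_polynomial_isHilbertCoeff_homology p (homProj p G (F.shift (l - 1)))
    (homProj p G (F.shift l)) (homProj p G (F.shift (l + 1))) ?_
    (extIn F (PolyA K n m) N l) (extOut F (PolyA K n m) N l) (hmap _ _ _ _ _ (F.out_degree l))
    (hmap _ _ _ _ _ (F.d_degree l)) ?_
    (fun k => homGrading (freeGrading (F.shift l)) (componentGrading (n := n) p 𝓝 k))
    (fun k => extIn F (PolyS K n) (component (n := n) p 𝓝 k) l)
    (fun k => extOut F (PolyS K n) (component (n := n) p 𝓝 k) l)
    (fun k => (component (n := n) p 𝓝 k).subtype.compRight (PolyS K n))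
    (fun k => (component (n := n) p 𝓝 k).subtype.compRight (PolyS K n))
    (fun k => (component (n := n) p 𝓝 k).subtype.compRight (PolyS K n))
    (fun k => hinj k _) (fun k => hinj k _) (fun k _ => rfl) (fun k _ => rfl)
    ?_ (fun k x => hι k x _ _) ?_ i j
  · intro c e a ha φ hφ y u hu
    have := smul_mem_of_gradedSMul 𝓝 _ _ _ ha _ (hφ y u hu)
    change a • φ u ∈ 𝓝 (y + (c + e).1, (c + e).2)
    convert this using 2
    ext
    · simp only [Prod.fst_add]; ring
    · rfl
  · intro φ
    refine LinearMap.ext fun u => ?_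
    change φ (F.out l (F.d l u)) = 0
    rw [F.out_d, map_zero]
  · intro k x v hv
    rw [← hι] at hv
    obtain ⟨u, -, hu⟩ := hv
    exact ⟨u, hu⟩
  · intro k φ c hc
    change (homEquiv K n _ N).symm _ = 0
    rw [LinearEquiv.symm_apply_eq, map_zero]
    funext b
    change G.π _ (homEquiv K n _ N _ b) = 0
    refine proj_component (n := n) p G (k := k) ?_ (by simpa using hc)
    rw [homEquiv_apply]
    exact (φ (Pi.single b 1)).2

end TorExt

theorem corollary3p4 {K : Type*} [Field K] (n m : ℕ) (p : Fin m → ℕ)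
    {M : Type*} [AddCommGroup M] [Module K M] [Module (PolyS K n) M]
    [IsScalarTower K (PolyS K n) M] [Module.Finite (PolyS K n) M]
    (𝓜 : ℤ → Submodule K M) [DirectSum.Decomposition 𝓜] [SetLike.GradedSMul (gradingS K n) 𝓜]
    {N : Type*} [AddCommGroup N] [Module K N] [Module (PolyS K n) N] [Module (PolyA K n m) N]
    [IsScalarTower K (PolyS K n) N] [IsScalarTower K (PolyA K n m) N]
    [IsScalarTower (PolyS K n) (PolyA K n m) N] [Module.Finite (PolyA K n m) N]
    (𝓝 : ℤ × ℤ → Submodule K N) [DirectSum.Decomposition 𝓝]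
    [SetLike.GradedSMul (gradingA K n p) 𝓝]
    (F : GradedFreeResolution (n := n) 𝓜) (l i j : ℕ) :
    (∃ q : Polynomial ℚ,
      (∀ᶠ k : ℤ in Filter.atTop,
        IsHilbertCoeff n (torGrading F (componentGrading (n := n) p 𝓝 k) l) i j
          (q.eval (k : ℚ))) ∧
      (q ≠ 0 → (q.natDegree : ℤ) ≤ m - 1 + j) ∧
      ((∃ p₀ : ℕ, ∀ t, p t = p₀) → q ≠ 0 →
        (q.natDegree : WithBot ℕ∞) + 1 ≤ fibreDim K n m (Tor F (PolyA K n m) N l) + j)) ∧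
    (∃ q : Polynomial ℚ,
      (∀ᶠ k : ℤ in Filter.atTop,
        IsHilbertCoeff n (extGrading F (componentGrading (n := n) p 𝓝 k) l) i j
          (q.eval (k : ℚ))) ∧
      (q ≠ 0 → (q.natDegree : ℤ) ≤ m - 1 + j) ∧
      ((∃ p₀ : ℕ, ∀ t, p t = p₀) → q ≠ 0 →
        (q.natDegree : WithBot ℕ∞) + 1 ≤ fibreDim K n m (Ext F (PolyA K n m) N l) + j)) := by
  obtain ⟨q, h1, h2, h3⟩ := exists_polynomial_tor p F (GradedProj.ofDecomposition 𝓝) l i j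
  obtain ⟨q', h1', h2', h3'⟩ := exists_polynomial_ext p F (GradedProj.ofDecomposition 𝓝) l i j
  exact ⟨⟨q, h1, h2, fun _ => h3⟩, ⟨q', h1', h2', fun _ => h3'⟩⟩
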